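/- For a finite field $\mathbb{F}_q$ with $q$ elements, a set $A\subseteq\mathbb{F}_q$ and $\xi\in\mathbb{F}_q^*$, let $E(A,\xi A)$ be the number of ordered quadruples $(a_1,a_2,a_3,a_4)\in A^4$ with $a_1-a_2=\xi(a_3-a_4)$. There are absolute constants $C_0,C>0$ and integers $k_0,k\ge 0$ such that the following holds for every finite field $\mathbb{F}_q$, all sets $A,X\subseteq\mathbb{F}_q^*$ with $A\neq\emptyset$, and every real $K\ge 1$. Suppose \[ C_0\log^{k_0}(q)\,K^{1505}\le |X| \qquad\text{and}\qquad \sum_{\xi\in X}E(A,\xi A)\ \ge\ \frac{|A|^3|X|}{K}. \] Then there exist an element $\bar a\in A$, a subfield $F\subseteq\mathbb{F}_q$ and an $F$-vector space $V\subseteq\mathbb{F}_q$ such that \[ C\log^{k}(q)\,|V\cap(A-\bar a)|\ \ge\ \max\{K^{-704}|V|,\ K^{-85}|A|\}, \] and, further, an element $x_0\in X$ and subsets $A_1\subseteq A-\bar a$ and $X'\subseteq x_0^{-1}X$ such that $F$ is the subfield generated by $X'$, $V$ is the $F$-vector space spanned by $A_1$, \[ C\log^{k}(q)\,|A_1|\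 \ge\ K^{-85}|A| \qquad\text{and}\qquad C\log^{k}(q)\,|X'|\ \ge\ K^{-5}|X|. \] Moreover, if $E(A,\xi A)\ge |A|^3/K$ for every $\xi\in X$, then the same conclusions hold with the last inequality replaced by $C\log^{k}(q)\,|X'|\ge K^{-4}|X|$, and only $C_0\log^{k_0}(q)\,K^{1504}\le|X|$ is required in place of $C_0\log^{k_0}(q)\,K^{1505}\le |X|$. -/

import Mathlib

/-- `E(A, ξA)`: the number of ordered quadruples `(a₁, a₂, a₃, a₄)` of elements of `A` with
`a₁ - a₂ = ξ (a₃ - a₄)`. -/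
def dilateEnergy {𝔽 : Type*} [Field 𝔽] [DecidableEq 𝔽] (A : Finset 𝔽) (ξ : 𝔽) : ℕ :=
  ((A ×ˢ A ×ˢ A ×ˢ A).filter fun t => t.1 - t.2.1 = ξ * (t.2.2.1 - t.2.2.2)).card

/-- The factor `C log^k q` implicit in the notation `≲` over the field with `q` elements:
`f ≲ g` means `f ≤ C log^k(q) g`. -/
noncomputable def logLoss (𝔽 : Type*) [Fintype 𝔽] (C : ℝ) (k : ℕ) : ℝ :=
  C * Real.log (Fintype.card 𝔽) ^ k

/-! The Balog–Szemerédi–Gowers theorem turns each large energy `E(A, ξA)` into large sets `A', B' ⊆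
A` with `|A' - ξB'| ≲ K⁵|A|`. The rectangles `A' × B'` are dense in `A × A`, so by a second moment
argument some `x₀` has a rectangle meeting those of many other `x`. Ruzsa's triangle inequality
along these intersections gives one set `B` and a large `Y ⊆ x₀⁻¹X` containing `1`, with `|B - yB| ≤
T|B|` for all `y ∈ Y` and `T ≈ K²⁶`.

Averaging the collisions of `b - xb'` then yields `b₀` such that for many `a ∈ B - b₀` the relation
`xa ∈ B - B` holds for many `x ∈ Y`; these `a` form `A₁`.

The heart is `card_span_le`. Call `v` good if `|B + vS| ≤ M|B|` for some dense `S ⊆ Y`. If `v` is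
good, a pigeonhole over pairs in `S` finds `y ≠ y'` with `x(y - y')v ∈ B - B` for many `x`.
Multiplying `B + (zv + a)x` by `y - y'` puts it inside a bounded sumset of `B`-dilates, and
Plünnecke–Ruzsa shows that `zv + a` is good with the same `M` and the same density. As nothing is
lost, the step iterates freely: the good elements contain the whole span of `A₁` over the field
generated by `Y`. Conversely a good `v` produces many solutions of `b + vs = b' + vs'`, and every
solution with `s ≠ s'` determines `v`, so there are `≲ |B|` good elements. -/

/-! ### Collisions and Cauchy–Schwarz. -/

section Counting

open Finset

/-- Cauchy–Schwarz for the number of collisions of a map on a finite set. -/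
theorem Finset.sq_card_le_card_image_mul_card_collisions {ι β : Type*} [DecidableEq β]
    (f : ι → β) (s : Finset ι) :
    s.card ^ 2 ≤ (s.image f).card * ((s ×ˢ s).filter fun p => f p.1 = f p.2).card := by
  classical
  have h1 : ((s ×ˢ s).filter fun p => f p.1 = f p.2).card
      = ∑ b ∈ s.image f, (s.filter fun a => f a = b).card ^ 2 := by
    rw [card_eq_sum_card_fiberwise (f := fun p : ι × ι => f p.1) (t := s.image f)]
    · refine sum_congr rfl fun b _ => ?_
      rw [sq, ← card_product]
      congr 1
      ext ⟨x, y⟩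
      simp only [mem_filter, mem_product]
      constructor
      · rintro ⟨⟨⟨hx, hy⟩, h⟩, h'⟩
        exact ⟨⟨hx, h'⟩, hy, h ▸ h'⟩
      · rintro ⟨⟨hx, h⟩, hy, h'⟩
        exact ⟨⟨⟨hx, hy⟩, h.trans h'.symm⟩, h⟩
    · intro p hp
      simp only [coe_filter, mem_product, Set.mem_ofPred_eq] at hp
      exact mem_coe.2 (mem_image_of_mem f hp.1.1)
  rw [h1, card_eq_sum_card_image f s]
  exact sq_sum_le_card_mul_sum_sq

end Counting

/-! ### Spans from stability under affine maps. -/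

section Span

/-- In a finite field, a set containing `0` and stable under the affine maps `v ↦ z v + a` with
`z ∈ Y` and `a ∈ A` contains the span of `A` over the subfield generated by `Y`, provided that
`1 ∈ Y` and `0 ∈ A`. -/
theorem span_closure_subset_of_affine_stable {𝔽 : Type*} [Field 𝔽] [Finite 𝔽] {Y A Q : Set 𝔽}
    (h1 : 1 ∈ Y) (hA : 0 ∈ A) (h0 : 0 ∈ Q)
    (hQ : ∀ v ∈ Q, ∀ z ∈ Y, ∀ a ∈ A, z * v + a ∈ Q) :
    (Submodule.span (Subfield.closure Y) A : Set 𝔽) ⊆ Q := by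
  have := Fintype.ofFinite 𝔽
  -- Stability is only given for forward operations. In a finite field inverses are powers, and
  -- negatives are multiples by `p - 1`, so nothing more is needed.
  have hinv : ∀ c : 𝔽, c ≠ 0 → ∃ n : ℕ, c⁻¹ = c ^ n := fun c hc => by
    refine ⟨Fintype.card 𝔽 - 2, ?_⟩
    have h2 : 1 < Fintype.card 𝔽 := Fintype.one_lt_card
    have := FiniteField.pow_card_sub_one_eq_one c hc
    rw [inv_eq_of_mul_eq_one_right]
    rw [← pow_succ', ← this]
    congr 1
    omega
  obtain ⟨p, hp⟩ := CharP.exists 𝔽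
  have hp0 : p ≠ 0 := CharP.char_ne_zero_of_finite 𝔽 p
  -- `Q` itself need not be additively closed. The translations preserving it are, and they lie in
  -- `Q` because `0 ∈ Q`.
  let N : Set 𝔽 := {g | ∀ v ∈ Q, v + g ∈ Q}
  have hNadd : ∀ g ∈ N, ∀ h ∈ N, g + h ∈ N := fun g hg h hh v hv => by
    rw [← add_assoc]
    exact hh _ (hg v hv)
  have hN0 : (0 : 𝔽) ∈ N := fun v hv => by rwa [add_zero]
  have hNneg : ∀ g ∈ N, -g ∈ N := fun g hg => by
    have hmul : ∀ n : ℕ, (n : 𝔽) * g ∈ N := fun n => by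
      induction n with
      | zero => simpa using hN0
      | succ n ih =>
        rw [Nat.cast_succ, add_mul, one_mul]
        exact hNadd _ ih _ hg
    have h := hmul (p - 1)
    have h2 : ((p - 1 : ℕ) : 𝔽) = -1 := by
      rw [Nat.cast_sub (Nat.one_le_iff_ne_zero.2 hp0), CharP.cast_eq_zero]
      simp
    rwa [h2, neg_one_mul] at h
  have hQmul : ∀ z ∈ Y, ∀ v ∈ Q, z * v ∈ Q := fun z hz v hv => by
    simpa using hQ v hv z hz 0 hA
  -- Uses `v + zg = z(z⁻¹v + g)`, where `z⁻¹v ∈ Q` because `z⁻¹` is a power of `z`.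
  have hNY : ∀ z ∈ Y, ∀ g ∈ N, z * g ∈ N := fun z hz g hg v hv => by
    rcases eq_or_ne z 0 with rfl | hz0
    · simpa using hv
    obtain ⟨n, hn⟩ := hinv z hz0
    have hpow : ∀ n : ℕ, z ^ n * v ∈ Q := fun n => by
      induction n with
      | zero => simpa using hv
      | succ n ih =>
        rw [pow_succ', mul_assoc]
        exact hQmul z hz _ ih
    have h3 := hQmul z hz _ (hg _ (hn ▸ hpow n))
    rwa [mul_add, ← mul_assoc, mul_inv_cancel₀ hz0, one_mul] at h3
  have hNF : ∀ c ∈ Subfield.closure Y, ∀ g ∈ N, c * g ∈ N := fun c hc => by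
    induction hc using Subfield.closure_induction with
    | mem x hx => exact hNY x hx
    | one => simp
    | add x y _ _ hx hy =>
      intro g hg
      rw [add_mul]
      exact hNadd _ (hx g hg) _ (hy g hg)
    | neg x _ hx =>
      intro g hg
      rw [neg_mul]
      exact hNneg _ (hx g hg)
    | inv x _ hx =>
      intro g hg
      rcases eq_or_ne x 0 with rfl | hx0
      · simpa using hN0
      obtain ⟨n, hn⟩ := hinv x hx0
      rw [hn]
      have : ∀ n : ℕ, x ^ n * g ∈ N := fun n => by
        induction n with
        | zero => simpa using hg
        | succ n ih =>
          rw [pow_succ', mul_assoc]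
          exact hx _ ih
      exact this n
    | mul x y _ _ hx hy =>
      intro g hg
      rw [mul_assoc]
      exact hx _ (hy g hg)
  intro v hv
  suffices hvN : v ∈ N by simpa using hvN 0 h0
  rw [SetLike.mem_coe] at hv
  induction hv using Submodule.span_induction with
  | mem x hx =>
    intro v hv
    simpa using hQ v hv 1 h1 x hx
  | zero => exact hN0
  | add x y _ _ hx hy => exact hNadd _ hx _ hy
  | smul c x _ hx => exact hNF c c.2 x hx

end Span

/-! ### The pivot: a difference `y - y'` that works for many `x`. -/

section Pivot

open Finset
open scoped Pointwise

variable {𝔽 : Type*} [Field 𝔽] [DecidableEq 𝔽]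

/-- The Plünnecke–Ruzsa inequality over the reals, for four plus and four minus signs. -/
theorem card_four_nsmul_sub_four_nsmul_le {B C : Finset 𝔽} {κ : ℝ} (hB : B.Nonempty)
    (h : ((B - C).card : ℝ) ≤ κ * B.card) :
    ((4 • C - 4 • C).card : ℝ) ≤ κ ^ 8 * B.card := by
  have h0 : (0 : ℝ) < B.card := by exact_mod_cast hB.card_pos
  have h1 := pluennecke_ruzsa_inequality_nsmul_sub_nsmul_sub hB C 4 4
  have h2 : ((4 • C - 4 • C).card : ℝ) ≤ (((B - C).card : ℝ) / B.card) ^ 8 * B.card := by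
    have h3 := (NNRat.cast_le (K := ℝ)).2 h1
    push_cast at h3
    exact h3
  refine h2.trans ?_
  gcongr
  rwa [div_le_iff₀ h0]

/-- If `|B + S v| ≤ M |B|`, then some difference `y - y'` of distinct elements of `S` has the
property that `x (y - y') v` is a difference of elements of `B` for many `x ∈ R`. -/
theorem exists_sub_mul_mem_sub {B S R : Finset 𝔽} {T M : ℝ} {v : 𝔽} (hB : B.Nonempty)
    (hT : 1 ≤ T) (hM : 1 ≤ M) (hR0 : 0 ∉ R) (hR : ∀ x ∈ R, ((B - x • B).card : ℝ) ≤ T * B.card)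
    (hS : 2 * T * M ≤ S.card) (hv : ((B + v • S).card : ℝ) ≤ M * B.card) :
    ∃ y ∈ S, ∃ y' ∈ S, y ≠ y' ∧
      (R.card : ℝ) ≤ 2 * T * M * (R.filter fun x => x * (y - y') * v ∈ B - B).card := by
  have hTM : 1 ≤ T * M := one_le_mul_of_one_le_of_one_le hT hM
  have hb : (0 : ℝ) < B.card := by exact_mod_cast hB.card_pos
  have hs : (0 : ℝ) < S.card := by nlinarith
  -- for every `x` there are many good pairs
  have key : ∀ x ∈ R, (S.card : ℝ) ^ 2 ≤
      2 * T * M * (S.offDiag.filter fun p => x * (p.1 - p.2) * v ∈ B - B).card := by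
    intro x hx
    have hx0 : x ≠ 0 := fun h => hR0 (h ▸ hx)
    -- Triangle inequality through `x • B`, using that `x • B + (x * v) • S` is a dilate of `B + v •
    -- S`.
    have hcard : ((B + (x * v) • S).card : ℝ) ≤ T * M * B.card := by
      have h1 := ruzsa_triangle_inequality_add_sub_add B (x • B) ((x * v) • S)
      have h2 : (x • B - B).card = (B - x • B).card := by rw [← card_neg, neg_sub]
      rw [h2, mul_comm] at h1
      rw [card_smul_finset₀ hx0, mul_smul, ← smul_add, card_smul_finset₀ hx0, ← mul_smul] at h1
      have h3 : ((B + (x * v) • S).card : ℝ) * B.card ≤ (B - x • B).card * (B + v • S).card := by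
        exact_mod_cast h1
      refine le_of_mul_le_mul_right (h3.trans ?_) hb
      calc ((B - x • B).card : ℝ) * (B + v • S).card ≤ (T * B.card) * (M * B.card) := by
            gcongr
            exact hR x hx
        _ = _ := by ring
    have hcol := sq_card_le_card_image_mul_card_collisions
      (fun p : 𝔽 × 𝔽 => p.1 + x * v * p.2) (B ×ˢ S)
    have himg : (B ×ˢ S).image (fun p : 𝔽 × 𝔽 => p.1 + x * v * p.2) = B + (x * v) • S := by
      ext z
      simp [mem_add, mem_smul_finset, Prod.exists, and_assoc]
    rw [himg, card_product] at hcol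
    set P := S.offDiag.filter fun p => x * (p.1 - p.2) * v ∈ B - B with hP
    have hcol2 : (((B ×ˢ S) ×ˢ (B ×ˢ S)).filter
        fun p => p.1.1 + x * v * p.1.2 = p.2.1 + x * v * p.2.2).card
          ≤ (P.card + S.card) * B.card := by
      rw [← S.diag_card, ← card_union_of_disjoint, ← card_product]
      · refine card_le_card_of_injOn (fun p => ((p.1.2, p.2.2), p.1.1)) ?_ ?_
        · rintro ⟨⟨b, s⟩, ⟨b', s'⟩⟩ h
          simp only [coe_filter, mem_product, Set.mem_ofPred_eq] at h
          obtain ⟨⟨⟨hb, hs⟩, hb', hs'⟩, h⟩ := h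
          simp only [coe_product, Set.mem_prod, mem_coe, mem_union, hP, mem_filter, mem_offDiag,
            mem_diag]
          refine ⟨?_, hb⟩
          rcases eq_or_ne s s' with rfl | hne
          · exact Or.inr ⟨hs, rfl⟩
          · refine Or.inl ⟨⟨hs, hs', hne⟩, mem_sub.2 ⟨b', hb', b, hb, ?_⟩⟩
            linear_combination -h
        · rintro ⟨⟨b, s⟩, ⟨b', s'⟩⟩ h ⟨⟨c, t⟩, ⟨c', t'⟩⟩ h' heq
          simp only [coe_filter, mem_product, Set.mem_ofPred_eq] at h h'
          simp only [Prod.mk.injEq] at heq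
          obtain ⟨⟨rfl, rfl⟩, rfl⟩ := heq
          have : b' = c' := by linear_combination h'.2 - h.2
          rw [this]
      · exact (S.disjoint_diag_offDiag.mono_right (filter_subset _ _)).symm
    have h4 : ((B.card : ℝ) * S.card) ^ 2 ≤ (T * M * B.card) * ((P.card + S.card) * B.card) := by
      calc ((B.card : ℝ) * S.card) ^ 2 ≤ (B + (x * v) • S).card *
            (((B ×ˢ S) ×ˢ (B ×ˢ S)).filter
              fun p => p.1.1 + x * v * p.1.2 = p.2.1 + x * v * p.2.2).card := by
            exact_mod_cast hcol
        _ ≤ _ := by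
            gcongr
            exact_mod_cast hcol2
    have h5 : (S.card : ℝ) ^ 2 ≤ T * M * (P.card + S.card) := by
      refine le_of_mul_le_mul_right (a := (B.card : ℝ) ^ 2) ?_ (by positivity)
      linarith
    -- As `|S| ≥ 2TM`, the diagonal pairs account for at most half of `|S|²`.
    nlinarith
  have hdisj : S.offDiag.Nonempty := by
    rw [← card_pos, offDiag_card, ← Nat.mul_sub_one]
    refine Nat.mul_pos ?_ (Nat.sub_pos_of_lt ?_)
    · exact_mod_cast hs
    have : (1 : ℝ) < S.card := by linarith
    exact_mod_cast this
  by_contra! hcon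
  have hsum : ∑ p ∈ S.offDiag,
      (2 * T * M * (R.filter fun x => x * (p.1 - p.2) * v ∈ B - B).card : ℝ)
        < ∑ _p ∈ S.offDiag, (R.card : ℝ) := by
    refine sum_lt_sum_of_nonempty hdisj fun p hp => ?_
    rw [mem_offDiag] at hp
    exact hcon p.1 hp.1 p.2 hp.2.1 hp.2.2
  have hswap : ∑ p ∈ S.offDiag, ((R.filter fun x => x * (p.1 - p.2) * v ∈ B - B).card : ℝ)
      = ∑ x ∈ R, ((S.offDiag.filter fun p => x * (p.1 - p.2) * v ∈ B - B).card : ℝ) := by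
    exact_mod_cast sum_card_bipartiteAbove_eq_sum_card_bipartiteBelow
      (s := S.offDiag) (t := R) fun p x => x * (p.1 - p.2) * v ∈ B - B
  rw [← mul_sum, hswap, mul_sum, sum_const, nsmul_eq_mul] at hsum
  have hlow := sum_le_sum key
  rw [sum_const, nsmul_eq_mul] at hlow
  have hoff : (S.offDiag.card : ℝ) ≤ (S.card : ℝ) ^ 2 := by
    have : S.offDiag.card ≤ S.card ^ 2 := by rw [offDiag_card, sq]; omega
    exact_mod_cast this
  nlinarith [mul_le_mul_of_nonneg_right hoff (Nat.cast_nonneg (α := ℝ) R.card)]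

end Pivot

/-! ### Goodness is preserved by affine steps; counting good elements. -/

section Pivot

open Finset
open scoped Pointwise

variable {𝔽 : Type*} [Field 𝔽] [DecidableEq 𝔽]

theorem mem_four_nsmul_sub_four_nsmul {C : Finset 𝔽} {a b c d a' b' c' d' : 𝔽}
    (ha : a ∈ C) (hb : b ∈ C) (hc : c ∈ C) (hd : d ∈ C)
    (ha' : a' ∈ C) (hb' : b' ∈ C) (hc' : c' ∈ C) (hd' : d' ∈ C) :
    a + b + c + d - (a' + b' + c' + d') ∈ 4 • C - 4 • C := by
  have h : (4 : ℕ) • C = C + C + C + C := by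
    rw [show (4 : ℕ) = 3 + 1 from rfl, succ_nsmul, show (3 : ℕ) = 2 + 1 from rfl, succ_nsmul,
      two_nsmul]
  rw [h]
  exact sub_mem_sub (add_mem_add (add_mem_add (add_mem_add ha hb) hc) hd)
    (add_mem_add (add_mem_add (add_mem_add ha' hb') hc') hd')

/-- If `x (y - y') v` and `x a` are differences of elements of `B` for all `x ∈ S`, then
`B + S (z v + a)` is small. -/
theorem card_add_smul_le {B S : Finset 𝔽} {T : ℝ} {y y' z v a : 𝔽} (hB : B.Nonempty)
    (hT : ((B - B).card : ℝ) ≤ T * B.card) (hy : ((B - y • B).card : ℝ) ≤ T * B.card)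
    (hy' : ((B - y' • B).card : ℝ) ≤ T * B.card) (hz : ((B - z • B).card : ℝ) ≤ T * B.card)
    (hne : y ≠ y') (hv : ∀ x ∈ S, x * (y - y') * v ∈ B - B) (ha : ∀ x ∈ S, x * a ∈ B - B) :
    ((B + (z * v + a) • S).card : ℝ) ≤ (4 * T) ^ 8 * B.card := by
  set C := B ∪ y • B ∪ y' • B ∪ z • B with hC
  have hBC : ((B - C).card : ℝ) ≤ 4 * T * B.card := by
    have h1 : (B - C).card ≤
        (B - B).card + (B - y • B).card + (B - y' • B).card + (B - z • B).card := by
      rw [hC, sub_union, sub_union, sub_union]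
      refine (card_union_le _ _).trans (Nat.add_le_add_right ?_ _)
      refine (card_union_le _ _).trans (Nat.add_le_add_right ?_ _)
      exact card_union_le _ _
    have h2 : ((B - C).card : ℝ) ≤
        (B - B).card + (B - y • B).card + (B - y' • B).card + (B - z • B).card := by
      exact_mod_cast h1
    linarith
  refine le_trans ?_ (card_four_nsmul_sub_four_nsmul_le hB hBC)
  -- After dilation by `y - y'`, an element reads `yb - y'b + z(b₁ - b₂) + (y - y')(b₃ - b₄)`: four
  -- terms of `C` minus four terms of `C`.
  rw [← card_smul_finset₀ (sub_ne_zero.2 hne) (B + (z * v + a) • S)]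
  norm_cast
  refine card_le_card fun w hw => ?_
  obtain ⟨u, hu, rfl⟩ := mem_smul_finset.1 hw
  obtain ⟨b, hb, t, ht, rfl⟩ := mem_add.1 hu
  obtain ⟨x, hx, rfl⟩ := mem_smul_finset.1 ht
  obtain ⟨b₁, hb₁, b₂, hb₂, h12⟩ := mem_sub.1 (hv x hx)
  obtain ⟨b₃, hb₃, b₄, hb₄, h34⟩ := mem_sub.1 (ha x hx)
  have memB : ∀ c ∈ B, c ∈ C := fun c hc => by simp [hC, hc]
  have memy : ∀ c ∈ B, y * c ∈ C := fun c hc => by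
    have := smul_mem_smul_finset (a := y) hc
    rw [smul_eq_mul] at this
    simp [hC, this]
  have memy' : ∀ c ∈ B, y' * c ∈ C := fun c hc => by
    have := smul_mem_smul_finset (a := y') hc
    rw [smul_eq_mul] at this
    simp [hC, this]
  have memz : ∀ c ∈ B, z * c ∈ C := fun c hc => by
    have := smul_mem_smul_finset (a := z) hc
    rw [smul_eq_mul] at this
    simp [hC, this]
  have h := mem_four_nsmul_sub_four_nsmul (memy b hb) (memz b₁ hb₁) (memy b₃ hb₃) (memy' b₄ hb₄)
    (memy' b hb) (memz b₂ hb₂) (memy b₄ hb₄) (memy' b₃ hb₃)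
  convert h using 1
  simp only [smul_eq_mul]
  linear_combination (-z) * h12 - (y - y') * h34

/-- If `V` is a finite set such that `|B + S v| ≤ M |B|` for every `v ∈ V` and some large subset
`S` of `Y`, then `V` is not much larger than `B`. -/
theorem card_le_of_card_add_smul_le {B Y V : Finset 𝔽} {M L : ℝ} (hB : B.Nonempty)
    (hM : 0 < M) (hL : 0 < L) (hY : 2 * L ^ 2 * M ≤ Y.card)
    (hV : ∀ v ∈ V, ∃ S ⊆ Y, (Y.card : ℝ) ≤ L * S.card ∧
      ((B + v • S).card : ℝ) ≤ M * B.card) :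
    (V.card : ℝ) ≤ 2 * L ^ 2 * M * B.card := by
  have hb : (0 : ℝ) < B.card := by exact_mod_cast hB.card_pos
  have hy : (0 : ℝ) < Y.card := lt_of_lt_of_le (by positivity) hY
  let c : 𝔽 → ℕ := fun v => (((B ×ˢ Y) ×ˢ (B ×ˢ Y)).filter
    fun p => p.1.1 + v * p.1.2 = p.2.1 + v * p.2.2).card
  have hlow : ∀ v ∈ V, (B.card : ℝ) * Y.card ^ 2 ≤ L ^ 2 * M * c v := by
    intro v hv
    obtain ⟨S, hSY, hS, hvS⟩ := hV v hv
    have hcol := sq_card_le_card_image_mul_card_collisions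
      (fun p : 𝔽 × 𝔽 => p.1 + v * p.2) (B ×ˢ S)
    have himg : (B ×ˢ S).image (fun p : 𝔽 × 𝔽 => p.1 + v * p.2) = B + v • S := by
      ext z
      simp [mem_add, mem_smul_finset, Prod.exists, and_assoc]
    rw [himg, card_product] at hcol
    have hmono : (((B ×ˢ S) ×ˢ (B ×ˢ S)).filter
        fun p => p.1.1 + v * p.1.2 = p.2.1 + v * p.2.2).card ≤ c v :=
      card_le_card (filter_subset_filter _ (product_subset_product
        (product_subset_product_right hSY) (product_subset_product_right hSY)))
    have h4 : ((B.card : ℝ) * S.card) ^ 2 ≤ (M * B.card) * c v := by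
      calc ((B.card : ℝ) * S.card) ^ 2 ≤ (B + v • S).card *
            (((B ×ˢ S) ×ˢ (B ×ˢ S)).filter
              fun p => p.1.1 + v * p.1.2 = p.2.1 + v * p.2.2).card := by
            exact_mod_cast hcol
        _ ≤ _ := by
            gcongr
    have h5 : (B.card : ℝ) * S.card ^ 2 ≤ M * c v := by
      refine le_of_mul_le_mul_right (a := (B.card : ℝ)) ?_ hb
      linarith
    calc (B.card : ℝ) * Y.card ^ 2 ≤ B.card * (L * S.card) ^ 2 := by gcongr
      _ = L ^ 2 * (B.card * S.card ^ 2) := by ring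
      _ ≤ L ^ 2 * (M * c v) := by gcongr
      _ = _ := by ring
  have hup : ∑ v ∈ V, c v ≤ V.card * (B.card * Y.card) + B.card ^ 2 * Y.card ^ 2 := by
    have h1 : ∑ v ∈ V, c v = ((V ×ˢ ((B ×ˢ Y) ×ˢ (B ×ˢ Y))).filter
        fun p => p.2.1.1 + p.1 * p.2.1.2 = p.2.2.1 + p.1 * p.2.2.2).card := by
      rw [card_filter, sum_product]
      exact sum_congr rfl fun v _ => card_filter _ _
    -- If the second coordinates agree, so do the first, which leaves `|V||B||Y|` trivial solutions;
    -- otherwise `v` is determined by the solution.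
    rw [h1, ← card_filter_add_card_filter_not (fun p : 𝔽 × (𝔽 × 𝔽) × 𝔽 × 𝔽 => p.2.1.2 = p.2.2.2)]
    refine Nat.add_le_add ?_ ?_
    · rw [← card_product, ← card_product]
      refine card_le_card_of_injOn (fun p => (p.1, p.2.1)) ?_ ?_
      · rintro ⟨v, ⟨b, s⟩, b', s'⟩ h
        simp only [coe_filter, mem_filter, mem_product, Set.mem_ofPred_eq] at h
        simp [h.1.1]
      · rintro ⟨v, ⟨b, s⟩, b', s'⟩ h ⟨w, ⟨d, t⟩, d', t'⟩ h' heq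
        simp only [coe_filter, mem_filter, mem_product, Set.mem_ofPred_eq] at h h'
        simp only [Prod.mk.injEq] at heq
        obtain ⟨rfl, rfl, rfl⟩ := heq
        obtain ⟨⟨-, h⟩, rfl⟩ := h
        obtain ⟨⟨-, h'⟩, rfl⟩ := h'
        rw [add_left_inj] at h h'
        rw [← h, ← h']
    · rw [← mul_pow, ← card_product, sq, ← card_product]
      refine card_le_card_of_injOn (fun p => p.2) ?_ ?_
      · rintro ⟨v, ⟨b, s⟩, b', s'⟩ h
        simp only [coe_filter, mem_filter, mem_product, Set.mem_ofPred_eq] at h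
        simp [h.1.1]
      · rintro ⟨v, ⟨b, s⟩, b', s'⟩ h ⟨w, ⟨d, t⟩, d', t'⟩ h' heq
        simp only [coe_filter, mem_filter, mem_product, Set.mem_ofPred_eq] at h h'
        simp only [Prod.mk.injEq] at heq
        obtain ⟨⟨rfl, rfl⟩, rfl, rfl⟩ := heq
        have : v = w := by
          refine mul_right_cancel₀ (sub_ne_zero.2 h.2) ?_
          linear_combination h.1.2 - h'.1.2
        rw [this]
  have hup' : ∑ v ∈ V, (c v : ℝ) ≤ V.card * (B.card * Y.card) + B.card ^ 2 * Y.card ^ 2 := by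
    exact_mod_cast hup
  have hsum := sum_le_sum hlow
  rw [sum_const, nsmul_eq_mul, ← mul_sum] at hsum
  have h6 : (V.card : ℝ) * (B.card * Y.card ^ 2) ≤
      L ^ 2 * M * (V.card * (B.card * Y.card) + B.card ^ 2 * Y.card ^ 2) :=
    hsum.trans (by gcongr)
  -- The largeness of `Y` lets the left side absorb the trivial solutions.
  have h7 : (V.card : ℝ) * (B.card * Y.card) * (2 * L ^ 2 * M) ≤
      (V.card : ℝ) * (B.card * Y.card) * Y.card := by gcongr
  refine le_of_mul_le_mul_right (a := (B.card : ℝ) * Y.card ^ 2) ?_ (by positivity)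
  linarith

/-- If every dilate `y B` with `y ∈ Y` has a small difference set with `B`, every `a ∈ A` is
such that `x a` is a difference of elements of `B` for many `x ∈ Y`, and `Y` is large, then `A`
spans a space not much larger than `B` over the subfield generated by `Y`. -/
theorem card_span_le [Finite 𝔽] {A B Y : Finset 𝔽} {T : ℝ} (hB : B.Nonempty) (hT : 1 ≤ T)
    (hY0 : 0 ∉ Y) (hY1 : 1 ∈ Y) (hY : ∀ y ∈ Y, ((B - y • B).card : ℝ) ≤ T * B.card)
    (hA : ∀ a ∈ A, (Y.card : ℝ) ≤ 2 * T * (Y.filter fun x => x * a ∈ B - B).card)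
    (hcard : 8 * T ^ 2 * ((4 * T) ^ 8) ^ 3 ≤ Y.card) :
    (Nat.card (Submodule.span (Subfield.closure (Y : Set 𝔽)) (A : Set 𝔽)) : ℝ) ≤
      8 * T ^ 2 * ((4 * T) ^ 8) ^ 3 * B.card := by
  have := Fintype.ofFinite 𝔽
  obtain ⟨M, hM⟩ : ∃ M, M = (4 * T) ^ 8 := ⟨_, rfl⟩
  rw [← hM] at hcard ⊢
  have hTM : T ≤ M := by
    calc T ≤ 4 * T := by linarith
      _ ≤ (4 * T) ^ 8 := le_self_pow₀ (by linarith) (by norm_num)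
      _ = M := hM.symm
  have hM1 : 1 ≤ M := hT.trans hTM
  have hBB : ((B - B).card : ℝ) ≤ T * B.card := by simpa using hY 1 hY1
  -- This makes every `S` of density `1 / (4T²M)` in `Y` have the `2TM` elements that the pivot
  -- needs.
  have hcard' : 2 * T * M * (4 * T ^ 2 * M) ≤ Y.card := by
    refine le_trans ?_ hcard
    have : T * (8 * T ^ 2 * M ^ 2) ≤ M * (8 * T ^ 2 * M ^ 2) := by gcongr
    linarith
  have h0B : (0 : 𝔽) ∈ B - B := by
    obtain ⟨b, hb⟩ := hB
    exact mem_sub.2 ⟨b, hb, b, hb, sub_self b⟩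
  -- one step of the affine action
  have step : ∀ v : 𝔽, ∀ S ⊆ Y, (Y.card : ℝ) ≤ 4 * T ^ 2 * M * S.card →
      ((B + v • S).card : ℝ) ≤ M * B.card → ∀ z ∈ Y, ∀ a : 𝔽, ∃ S' ⊆ Y,
        ((Y.filter fun x => x * a ∈ B - B).card : ℝ) ≤ 2 * T * M * S'.card ∧
        ((B + (z * v + a) • S').card : ℝ) ≤ M * B.card := by
    intro v S hSY hS hv z hz a
    have hS' : 2 * T * M ≤ S.card := by
      have := hcard'.trans hS
      rw [mul_comm] at this
      exact le_of_mul_le_mul_left this (by positivity)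
    obtain ⟨y, hy, y', hy', hne, hR⟩ := exists_sub_mul_mem_sub
      (R := Y.filter fun x => x * a ∈ B - B) hB hT hM1 (fun h => hY0 (mem_filter.1 h).1)
      (fun x hx => hY x (mem_filter.1 hx).1) hS' hv
    refine ⟨_, (filter_subset _ _).trans (filter_subset _ _), hR, ?_⟩
    rw [hM]
    refine card_add_smul_le hB hBB (hY y (hSY hy)) (hY y' (hSY hy')) (hY z hz) hne
      (fun x hx => (mem_filter.1 hx).2) fun x hx => (mem_filter.1 (mem_filter.1 hx).1).2
  have hYpos : (0 : ℝ) < Y.card := by exact_mod_cast (card_pos.2 ⟨1, hY1⟩)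
  set Q : Set 𝔽 := {v | ∃ S ⊆ Y, (Y.card : ℝ) ≤ 4 * T ^ 2 * M * S.card ∧
    ((B + v • S).card : ℝ) ≤ M * B.card} with hQ
  have hA0 : ∀ a ∈ insert (0 : 𝔽) (A : Set 𝔽),
      (Y.card : ℝ) ≤ 2 * T * (Y.filter fun x => x * a ∈ B - B).card := by
    rintro a (rfl | ha)
    · have : (Y.filter fun x => x * 0 ∈ B - B) = Y := by simp [h0B]
      rw [this]
      nlinarith
    · exact hA a ha
  have hsub := span_closure_subset_of_affine_stable (Y := (Y : Set 𝔽))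
    (A := insert (0 : 𝔽) (A : Set 𝔽)) (Q := Q) hY1 (Set.mem_insert _ _) ?_ ?_
  · rw [Submodule.span_insert_zero] at hsub
    have hfin : (Nat.card (Submodule.span (Subfield.closure (Y : Set 𝔽)) (A : Set 𝔽)))
        = (Set.toFinite (Submodule.span (Subfield.closure (Y : Set 𝔽)) (A : Set 𝔽) : Set 𝔽)).toFinset.card := by
      rw [← Set.ncard_eq_toFinset_card]
      rfl
    rw [hfin]
    have h := card_le_of_card_add_smul_le (Y := Y) (M := M) (L := 2 * T * M)
      (V := (Set.toFinite (Submodule.span (Subfield.closure (Y : Set 𝔽)) (A : Set 𝔽) : Set 𝔽)).toFinset)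
      hB (by positivity) (by positivity) ?_ ?_
    · refine h.trans_eq (by ring)
    · refine le_trans (le_of_eq ?_) hcard
      ring
    · intro v hv
      obtain ⟨S, hSY, hS, hvS⟩ := hsub ((Set.Finite.mem_toFinset _).1 hv)
      -- One more step, with the identity map, improves the density of `S` from `1 / (4T²M)` to `1 /
      -- (2TM)`, since no `x` is discarded for `a = 0`.
      obtain ⟨S', hS'Y, hS', hvS'⟩ := step v S hSY hS hvS 1 hY1 0
      have : (Y.filter fun x => x * 0 ∈ B - B) = Y := by simp [h0B]
      rw [this] at hS'
      rw [one_mul, add_zero] at hvS'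
      exact ⟨S', hS'Y, hS', hvS'⟩
  · refine ⟨Y, subset_rfl, ?_, ?_⟩
    · have : 1 ≤ 4 * T ^ 2 * M := by nlinarith [one_le_mul_of_one_le_of_one_le hT hT]
      nlinarith
    · have h1 : (B + (0 : 𝔽) • Y).card ≤ B.card := by
        rw [zero_smul_finset ⟨1, hY1⟩]
        simp
      have h2 : ((B + (0 : 𝔽) • Y).card : ℝ) ≤ B.card := by exact_mod_cast h1
      nlinarith [Nat.cast_nonneg (α := ℝ) B.card]
  · rintro v ⟨S, hSY, hS, hvS⟩ z hz a ha
    obtain ⟨S', hS'Y, hS', hvS'⟩ := step v S hSY hS hvS z hz a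
    refine ⟨S', hS'Y, ?_, hvS'⟩
    calc (Y.card : ℝ) ≤ 2 * T * (Y.filter fun x => x * a ∈ B - B).card := hA0 a ha
      _ ≤ 2 * T * (2 * T * M * S'.card) := by gcongr
      _ = _ := by ring

/-- If every dilate `y B` with `y ∈ Y` has a small difference set with `B`, then for some `b₀ ∈ B`
many of the elements `a` of `B - b₀` are such that `x a` is a difference of elements of `B` for
many `x ∈ Y`. -/
theorem exists_many_mul_mem_sub {B Y : Finset 𝔽} {T : ℝ} (hB : B.Nonempty) (hT : 1 ≤ T)
    (hY : ∀ y ∈ Y, ((B - y • B).card : ℝ) ≤ T * B.card) (hYne : Y.Nonempty) :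
    ∃ b₀ ∈ B, (B.card : ℝ) ≤ 2 * T * (B.filter fun b => (Y.card : ℝ) ≤
      2 * T * (Y.filter fun x => x * (b - b₀) ∈ B - B).card).card := by
  have hb : (0 : ℝ) < B.card := by exact_mod_cast hB.card_pos
  have hy : (0 : ℝ) < Y.card := by exact_mod_cast hYne.card_pos
  let n : 𝔽 → 𝔽 → ℕ := fun b₀ b => (Y.filter fun x => x * (b - b₀) ∈ B - B).card
  have key : ∀ x ∈ Y, (B.card : ℝ) ^ 2 ≤
      T * ((B ×ˢ B).filter fun p => x * (p.2 - p.1) ∈ B - B).card := by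
    intro x hx
    have hcol := sq_card_le_card_image_mul_card_collisions
      (fun p : 𝔽 × 𝔽 => p.1 - x * p.2) (B ×ˢ B)
    have himg : (B ×ˢ B).image (fun p : 𝔽 × 𝔽 => p.1 - x * p.2) = B - x • B := by
      ext z
      simp [mem_sub, mem_smul_finset, Prod.exists, and_assoc]
    rw [himg, card_product] at hcol
    have hcol2 : (((B ×ˢ B) ×ˢ (B ×ˢ B)).filter
        fun p => p.1.1 - x * p.1.2 = p.2.1 - x * p.2.2).card
          ≤ ((B ×ˢ B).filter fun p => x * (p.2 - p.1) ∈ B - B).card * B.card := by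
      rw [← card_product]
      refine card_le_card_of_injOn (fun p => ((p.1.2, p.2.2), p.1.1)) ?_ ?_
      · rintro ⟨⟨b, s⟩, ⟨b', s'⟩⟩ h
        simp only [coe_filter, mem_product, Set.mem_ofPred_eq] at h
        obtain ⟨⟨⟨hb, hs⟩, hb', hs'⟩, h⟩ := h
        simp only [coe_product, Set.mem_prod, mem_coe, mem_filter, mem_product]
        refine ⟨⟨⟨hs, hs'⟩, mem_sub.2 ⟨b', hb', b, hb, ?_⟩⟩, hb⟩
        linear_combination -h
      · rintro ⟨⟨b, s⟩, ⟨b', s'⟩⟩ h ⟨⟨c, t⟩, ⟨c', t'⟩⟩ h' heq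
        simp only [coe_filter, mem_product, Set.mem_ofPred_eq] at h h'
        simp only [Prod.mk.injEq] at heq
        obtain ⟨⟨rfl, rfl⟩, rfl⟩ := heq
        have : b' = c' := by linear_combination h'.2 - h.2
        rw [this]
    refine le_of_mul_le_mul_right (a := (B.card : ℝ) ^ 2) ?_ (by positivity)
    calc (B.card : ℝ) ^ 2 * B.card ^ 2 = ((B.card : ℝ) * B.card) ^ 2 := by ring
      _ ≤ ((B - x • B).card : ℝ) * (((B ×ˢ B) ×ˢ (B ×ˢ B)).filter
        fun p => p.1.1 - x * p.1.2 = p.2.1 - x * p.2.2).card := by exact_mod_cast hcol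
      _ ≤ (T * B.card) * (((B ×ˢ B).filter fun p => x * (p.2 - p.1) ∈ B - B).card * B.card) := by
        gcongr
        · exact hY x hx
        · exact_mod_cast hcol2
      _ = _ := by ring
  have hswap : ∑ x ∈ Y, (((B ×ˢ B).filter fun p => x * (p.2 - p.1) ∈ B - B).card : ℝ)
      = ∑ b₀ ∈ B, ∑ b ∈ B, (n b₀ b : ℝ) := by
    rw [← sum_product' (f := fun b₀ b => (n b₀ b : ℝ))]
    exact_mod_cast (sum_card_bipartiteAbove_eq_sum_card_bipartiteBelow
      (s := Y) (t := B ×ˢ B) fun x p => x * (p.2 - p.1) ∈ B - B)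
  have hsum := sum_le_sum key
  rw [sum_const, nsmul_eq_mul, ← mul_sum, hswap, mul_sum] at hsum
  -- An average choice of `b₀`; the `b` below the threshold then contribute at most half of the sum.
  obtain ⟨b₀, hb₀, h⟩ : ∃ b₀ ∈ B, (Y.card : ℝ) * B.card ≤ T * ∑ b ∈ B, (n b₀ b : ℝ) := by
    refine exists_le_of_sum_le hB ?_
    rw [sum_const, nsmul_eq_mul]
    linarith
  refine ⟨b₀, hb₀, ?_⟩
  rw [← sum_filter_add_sum_filter_not B fun b => (Y.card : ℝ) ≤ 2 * T * n b₀ b] at h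
  set G := B.filter fun b => (Y.card : ℝ) ≤ 2 * T * n b₀ b
  have h1 : ∑ b ∈ G, (n b₀ b : ℝ) ≤ G.card * Y.card := by
    rw [← nsmul_eq_mul]
    exact sum_le_card_nsmul _ _ _ fun b _ => by exact_mod_cast card_filter_le _ _
  have h2 : ∑ b ∈ B.filter (fun b => ¬ (Y.card : ℝ) ≤ 2 * T * n b₀ b), 2 * T * (n b₀ b : ℝ)
      ≤ B.card * Y.card := by
    refine (sum_le_card_nsmul _ _ (Y.card : ℝ) fun b hb => ?_).trans ?_
    · exact (not_le.1 (mem_filter.1 hb).2).le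
    · rw [nsmul_eq_mul]
      gcongr
      exact filter_subset _ _
  rw [← mul_sum] at h2
  refine le_of_mul_le_mul_right (a := (Y.card : ℝ)) ?_ hy
  have h3 : T * ∑ b ∈ G, (n b₀ b : ℝ) ≤ T * (G.card * Y.card) := by gcongr
  linarith

end Pivot

/-! ### Paths of length three, and intersections of dense sets. -/

section Paths

open Finset

/-- In a bipartite graph of density at least `γ` there are large sets of vertices `A'` and `B'` on
the two sides with all pairs in `A' × B'` joined by many paths of length three. -/
theorem exists_many_paths_of_length_three {α β : Type*} (A : Finset α)
    (B : Finset β) (r : α → β → Prop) [∀ a b, Decidable (r a b)] {γ : ℝ} (hγ : 0 < γ)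
    (hA : A.Nonempty) (hB : B.Nonempty)
    (h : γ * (A.card * B.card) ≤ ((A ×ˢ B).filter fun p => r p.1 p.2).card) :
    ∃ A' ⊆ A, ∃ B' ⊆ B, γ * A.card ≤ 6 * A'.card ∧ γ * B.card ≤ 4 * B'.card ∧
      ∀ a ∈ A', ∀ b ∈ B', γ ^ 5 * (A.card * B.card) ≤
        3072 * ((A ×ˢ B).filter fun p => r a p.2 ∧ r p.1 p.2 ∧ r p.1 b).card := by
  classical
  have ha : (0 : ℝ) < A.card := by exact_mod_cast hA.card_pos
  have hb : (0 : ℝ) < B.card := by exact_mod_cast hB.card_pos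
  let deg : α → ℕ := fun a => (B.filter fun b => r a b).card
  -- Discarding vertices of low degree keeps half of the edges, and later makes every vertex of `N`
  -- have large degree, which is what makes `B'` large.
  set A₀ := A.filter fun a => γ * B.card ≤ 2 * deg a with hA₀
  have hdeg : γ * (A.card * B.card) ≤ 2 * ∑ a ∈ A₀, (deg a : ℝ) := by
    have h1 : ((A ×ˢ B).filter fun p => r p.1 p.2).card = ∑ a ∈ A, deg a := by
      rw [card_filter, sum_product]
      exact sum_congr rfl fun a _ => (card_filter _ _).symm
    have h2 : γ * (A.card * B.card) ≤ ∑ a ∈ A, (deg a : ℝ) := by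
      rw [h1] at h
      exact_mod_cast h
    rw [← sum_filter_add_sum_filter_not A fun a => γ * B.card ≤ 2 * deg a] at h2
    have h3 : ∑ a ∈ A.filter (fun a => ¬ γ * B.card ≤ 2 * deg a), 2 * (deg a : ℝ)
        ≤ A.card * (γ * B.card) := by
      refine (sum_le_card_nsmul _ _ (γ * B.card) fun a ha => ?_).trans ?_
      · exact (not_le.1 (mem_filter.1 ha).2).le
      · rw [nsmul_eq_mul]
        gcongr
        exact filter_subset _ _
    rw [← mul_sum] at h3
    linarith
  let nb : β → Finset α := fun b => A₀.filter fun a => r a b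
  have hnb : ∀ S ⊆ A₀, ∑ b ∈ B, ((S.filter fun a => r a b).card : ℝ) = ∑ a ∈ S, (deg a : ℝ) :=
    fun S _ => by
      exact_mod_cast (sum_card_bipartiteAbove_eq_sum_card_bipartiteBelow
        (s := S) (t := B) fun a b => r a b).symm
  let codeg : α → α → ℕ := fun a a' => (B.filter fun b => r a b ∧ r a' b).card
  let bad : α → α → Prop := fun a a' => 128 * (codeg a a' : ℝ) < γ ^ 3 * B.card
  have hsq : γ ^ 2 * A.card ^ 2 * B.card ≤ 4 * ∑ b ∈ B, ((nb b).card : ℝ) ^ 2 := by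
    have h1 := sq_sum_le_card_mul_sum_sq (s := B) (f := fun b => ((nb b).card : ℝ))
    rw [hnb A₀ subset_rfl] at h1
    have h2 : (γ * (A.card * B.card)) ^ 2 ≤ (2 * ∑ a ∈ A₀, (deg a : ℝ)) ^ 2 := by gcongr
    refine le_of_mul_le_mul_right (a := (B.card : ℝ)) ?_ hb
    linarith
  have hbad : 128 * ∑ b ∈ B, ((((nb b) ×ˢ (nb b)).filter fun p => bad p.1 p.2).card : ℝ)
      ≤ A.card ^ 2 * (γ ^ 3 * B.card) := by
    have h1 : ∑ b ∈ B, ((((nb b) ×ˢ (nb b)).filter fun p => bad p.1 p.2).card : ℝ)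
        = ∑ p ∈ (A₀ ×ˢ A₀).filter (fun p => bad p.1 p.2), (codeg p.1 p.2 : ℝ) := by
      have h2 := sum_card_bipartiteAbove_eq_sum_card_bipartiteBelow
        (s := (A₀ ×ˢ A₀).filter (fun p => bad p.1 p.2)) (t := B) fun p b => r p.1 b ∧ r p.2 b
      have h3 : ∀ b, ((nb b) ×ˢ (nb b)).filter (fun p => bad p.1 p.2) =
          bipartiteBelow (fun (p : α × α) b => r p.1 b ∧ r p.2 b)
            ((A₀ ×ˢ A₀).filter (fun p => bad p.1 p.2)) b := by
        intro b
        ext p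
        simp only [nb, bipartiteBelow, mem_filter, mem_product]
        tauto
      simp only [h3]
      exact_mod_cast h2.symm
    rw [h1, mul_sum]
    refine (sum_le_card_nsmul _ _ (γ ^ 3 * B.card) fun p hp => (mem_filter.1 hp).2.le).trans ?_
    rw [nsmul_eq_mul]
    gcongr
    have : ((A₀ ×ˢ A₀).filter fun p => bad p.1 p.2).card ≤ A.card ^ 2 := by
      refine (card_filter_le _ _).trans ?_
      rw [card_product, sq]
      exact Nat.mul_le_mul (card_filter_le _ _) (card_filter_le _ _)
    exact_mod_cast this
  -- A single averaged inequality secures both that the neighbourhood of `b₀` is large and that few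
  -- of its pairs have small codegree.
  obtain ⟨b₀, -, hb₀⟩ : ∃ b ∈ B, γ ^ 3 * A.card ^ 2 + 128 *
      ((((nb b) ×ˢ (nb b)).filter fun p => bad p.1 p.2).card : ℝ) ≤
        8 * γ * ((nb b).card : ℝ) ^ 2 := by
    refine exists_le_of_sum_le hB ?_
    rw [sum_add_distrib, sum_const, nsmul_eq_mul, ← mul_sum, ← mul_sum]
    have : γ * (γ ^ 2 * A.card ^ 2 * B.card) ≤ γ * (4 * ∑ b ∈ B, ((nb b).card : ℝ) ^ 2) := by
      gcongr
    linarith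
  set N := nb b₀ with hN
  have hNA₀ : N ⊆ A₀ := filter_subset _ _
  have hNA : N ⊆ A := hNA₀.trans (filter_subset _ _)
  have hNcard : γ * A.card ≤ 3 * N.card := by
    refine le_of_sq_le_sq (a := γ * A.card) ?_ (by positivity)
    have h1 : γ * (γ ^ 2 * A.card ^ 2) ≤ γ * (8 * (N.card : ℝ) ^ 2) := by
      have : (0 : ℝ) ≤ 128 * (((N ×ˢ N).filter fun p => bad p.1 p.2).card : ℝ) := by positivity
      linarith
    have h2 := le_of_mul_le_mul_left h1 hγ
    nlinarith [sq_nonneg (N.card : ℝ)]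
  have hn : (0 : ℝ) < N.card := by
    have : 0 < γ * A.card := by positivity
    linarith
  have hbadN : 16 * (((N ×ˢ N).filter fun p => bad p.1 p.2).card : ℝ) ≤ γ * (N.card : ℝ) ^ 2 := by
    have : 0 ≤ γ ^ 3 * (A.card : ℝ) ^ 2 := by positivity
    linarith
  refine ⟨N.filter fun a => 8 * ((N.filter fun a' => bad a a').card : ℝ) ≤ γ * N.card,
    (filter_subset _ _).trans hNA,
    B.filter fun b => γ * N.card ≤ 4 * ((N.filter fun a => r a b).card : ℝ),
    filter_subset _ _, ?_, ?_, ?_⟩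
  · have h1 : ((N ×ˢ N).filter fun p => bad p.1 p.2).card
        = ∑ a ∈ N, (N.filter fun a' => bad a a').card := by
      rw [card_filter, sum_product]
      exact sum_congr rfl fun a _ => (card_filter _ _).symm
    rw [h1] at hbadN
    push_cast at hbadN
    set G := N.filter fun a => 8 * ((N.filter fun a' => bad a a').card : ℝ) ≤ γ * N.card with hG
    set G' := N.filter fun a => ¬ 8 * ((N.filter fun a' => bad a a').card : ℝ) ≤ γ * N.card
      with hG'
    have h2 : (G.card : ℝ) + G'.card = N.card := by
      rw [← Nat.cast_add, hG, hG', card_filter_add_card_filter_not]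
    have h3 : (G'.card : ℝ) * (γ * N.card) ≤
        ∑ a ∈ G', 8 * ((N.filter fun a' => bad a a').card : ℝ) := by
      rw [← nsmul_eq_mul]
      exact card_nsmul_le_sum _ _ _ fun a ha => (not_le.1 (mem_filter.1 ha).2).le
    have h4 : ∑ a ∈ G', 8 * ((N.filter fun a' => bad a a').card : ℝ) ≤
        ∑ a ∈ N, 8 * ((N.filter fun a' => bad a a').card : ℝ) :=
      sum_le_sum_of_subset_of_nonneg (filter_subset _ _) fun _ _ _ => by positivity
    rw [← mul_sum N] at h4
    have h5 : (2 * G'.card : ℝ) * (γ * N.card) ≤ N.card * (γ * N.card) := by linarith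
    have h6 := le_of_mul_le_mul_right h5 (by positivity)
    linarith
  · have h1 := hnb N hNA₀
    have h2 : (N.card : ℝ) * (γ * B.card) ≤ ∑ a ∈ N, 2 * (deg a : ℝ) := by
      rw [← nsmul_eq_mul]
      exact card_nsmul_le_sum _ _ _ fun a ha => (mem_filter.1 (hNA₀ ha)).2
    rw [← mul_sum, ← h1,
      ← sum_filter_add_sum_filter_not B fun b =>
        γ * N.card ≤ 4 * ((N.filter fun a => r a b).card : ℝ)] at h2
    set G := B.filter fun b => γ * N.card ≤ 4 * ((N.filter fun a => r a b).card : ℝ)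
    have h3 : ∑ b ∈ G, ((N.filter fun a => r a b).card : ℝ) ≤ G.card * N.card := by
      rw [← nsmul_eq_mul]
      exact sum_le_card_nsmul _ _ _ fun b _ => by exact_mod_cast card_filter_le _ _
    have h4 : ∑ b ∈ B.filter (fun b => ¬ γ * N.card ≤ 4 * ((N.filter fun a => r a b).card : ℝ)),
        4 * ((N.filter fun a => r a b).card : ℝ) ≤ B.card * (γ * N.card) := by
      refine (sum_le_card_nsmul _ _ (γ * N.card) fun b hb => ?_).trans ?_
      · exact (not_le.1 (mem_filter.1 hb).2).le
      · rw [nsmul_eq_mul]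
        gcongr
        exact filter_subset _ _
    rw [← mul_sum] at h4
    refine le_of_mul_le_mul_right (a := (N.card : ℝ)) ?_ hn
    linarith
  · intro a ha b hb
    have ha := (mem_filter.1 ha).2
    have hb := (mem_filter.1 hb).2
    set S := (N.filter fun a' => r a' b).filter fun a' => ¬ bad a a' with hS
    -- At least `γ|N|/4` neighbours of `b` lie in `N`, and at most `γ|N|/8` elements of `N` are bad
    -- for `a`.
    have hScard : γ * N.card ≤ 8 * S.card := by
      have h1 : ((N.filter fun a' => r a' b).card : ℝ) ≤
          (N.filter fun a' => bad a a').card + S.card := by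
        have h2 : N.filter (fun a' => r a' b) ⊆ N.filter (fun a' => bad a a') ∪ S := by
          intro x hx
          by_cases h : bad a x
          · exact mem_union_left _ (mem_filter.2 ⟨(mem_filter.1 hx).1, h⟩)
          · exact mem_union_right _ (mem_filter.2 ⟨hx, h⟩)
        exact_mod_cast (card_le_card h2).trans (card_union_le _ _)
      linarith
    have hpath : ∑ a' ∈ S, codeg a a' ≤
        ((A ×ˢ B).filter fun p => r a p.2 ∧ r p.1 p.2 ∧ r p.1 b).card := by
      have h1 : ∑ a' ∈ S, codeg a a' =
          ((S ×ˢ B).filter fun p => r a p.2 ∧ r p.1 p.2).card := by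
        rw [card_filter, sum_product]
        exact sum_congr rfl fun a _ => card_filter _ _
      rw [h1]
      refine card_le_card fun p hp => ?_
      simp only [hS, mem_filter, mem_product] at hp ⊢
      exact ⟨⟨hNA hp.1.1.1.1, hp.1.2⟩, hp.2.1, hp.2.2, hp.1.1.1.2⟩
    have h2 : (S.card : ℝ) * (γ ^ 3 * B.card) ≤ ∑ a' ∈ S, 128 * (codeg a a' : ℝ) := by
      rw [← nsmul_eq_mul]
      exact card_nsmul_le_sum _ _ _ fun a ha => not_lt.1 (mem_filter.1 ha).2
    rw [← mul_sum] at h2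
    have h3 : ∑ a' ∈ S, (codeg a a' : ℝ) ≤
        ((A ×ˢ B).filter fun p => r a p.2 ∧ r p.1 p.2 ∧ r p.1 b).card := by
      exact_mod_cast hpath
    calc γ ^ 5 * (A.card * B.card) = γ ^ 4 * B.card * (γ * A.card) := by ring
      _ ≤ γ ^ 4 * B.card * (3 * N.card) := by gcongr
      _ = 3 * γ ^ 3 * B.card * (γ * N.card) := by ring
      _ ≤ 3 * γ ^ 3 * B.card * (8 * S.card) := by gcongr
      _ = 24 * (S.card * (γ ^ 3 * B.card)) := by ring
      _ ≤ 24 * (128 * ∑ a' ∈ S, (codeg a a' : ℝ)) := by gcongr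
      _ ≤ _ := by linarith

/-- Among sets `P x` of density at least `δ` there is one that meets many of the others in a set
of density at least `δ² / 2`. -/
theorem exists_many_large_inter {ι α : Type*} [DecidableEq α] (X : Finset ι) (Ω : Finset α)
    (P : ι → Finset α) {δ : ℝ} (hδ : 0 < δ) (hX : X.Nonempty) (hΩ : Ω.Nonempty)
    (hP : ∀ x ∈ X, P x ⊆ Ω) (h : ∀ x ∈ X, δ * Ω.card ≤ (P x).card) :
    ∃ x₀ ∈ X, δ ^ 2 * X.card ≤
      2 * (X.filter fun x => δ ^ 2 * Ω.card ≤ 2 * ((P x ∩ P x₀).card : ℝ)).card := by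
  classical
  have hω : (0 : ℝ) < Ω.card := by exact_mod_cast hΩ.card_pos
  have hx : (0 : ℝ) < X.card := by exact_mod_cast hX.card_pos
  have h1 : ∑ ω ∈ Ω, ((X.filter fun x => ω ∈ P x).card : ℝ) = ∑ x ∈ X, ((P x).card : ℝ) := by
    have h2 := sum_card_bipartiteAbove_eq_sum_card_bipartiteBelow
        (s := Ω) (t := X) fun ω x => ω ∈ P x
    have h3 : ∀ x ∈ X, bipartiteBelow (fun ω x => ω ∈ P x) Ω x = P x := fun x hx => by
      ext ω
      simp only [bipartiteBelow, mem_filter]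
      exact ⟨fun h => h.2, fun h => ⟨hP x hx h, h⟩⟩
    rw [sum_congr rfl fun x hx => congrArg card (h3 x hx)] at h2
    exact_mod_cast h2
  have h4 : ∑ ω ∈ Ω, ((X.filter fun x => ω ∈ P x).card : ℝ) ^ 2 =
      ∑ x₀ ∈ X, ∑ x ∈ X, ((P x ∩ P x₀).card : ℝ) := by
    rw [← sum_product' (f := fun x₀ x => ((P x ∩ P x₀).card : ℝ))]
    have h2 := sum_card_bipartiteAbove_eq_sum_card_bipartiteBelow
        (s := Ω) (t := X ×ˢ X) fun ω p => ω ∈ P p.1 ∧ ω ∈ P p.2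
    have h3 : ∀ p ∈ X ×ˢ X,
        bipartiteBelow (fun ω (p : ι × ι) => ω ∈ P p.1 ∧ ω ∈ P p.2) Ω p = P p.2 ∩ P p.1 :=
      fun p hp => by
        ext ω
        simp only [bipartiteBelow, mem_filter, mem_inter]
        exact ⟨fun h => h.2.symm, fun h => ⟨hP _ (mem_product.1 hp).2 h.1, h.symm⟩⟩
    have h5 : ∀ ω, bipartiteAbove (fun ω (p : ι × ι) => ω ∈ P p.1 ∧ ω ∈ P p.2) (X ×ˢ X) ω =
        (X.filter fun x => ω ∈ P x) ×ˢ (X.filter fun x => ω ∈ P x) := fun ω => by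
      ext p
      simp only [bipartiteAbove, mem_filter, mem_product]
      tauto
    rw [sum_congr rfl fun x hx => congrArg card (h3 x hx)] at h2
    simp only [h5, card_product, ← sq] at h2
    exact_mod_cast h2
  have h5 := sq_sum_le_card_mul_sum_sq (s := Ω)
    (f := fun ω => ((X.filter fun x => ω ∈ P x).card : ℝ))
  rw [h1, h4] at h5
  have h6 : (X.card : ℝ) * (δ * Ω.card) ≤ ∑ x ∈ X, ((P x).card : ℝ) := by
    rw [← nsmul_eq_mul]
    exact card_nsmul_le_sum _ _ _ h
  have h7 : ((X.card : ℝ) * (δ * Ω.card)) ^ 2 ≤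
      Ω.card * ∑ x₀ ∈ X, ∑ x ∈ X, ((P x ∩ P x₀).card : ℝ) :=
    le_trans (by gcongr) h5
  obtain ⟨x₀, hx₀, h8⟩ : ∃ x₀ ∈ X, δ ^ 2 * X.card * Ω.card ≤
      ∑ x ∈ X, ((P x ∩ P x₀).card : ℝ) := by
    refine exists_le_of_sum_le hX ?_
    rw [sum_const, nsmul_eq_mul]
    refine le_of_mul_le_mul_left (a := (Ω.card : ℝ)) ?_ hω
    linarith
  refine ⟨x₀, hx₀, ?_⟩
  rw [← sum_filter_add_sum_filter_not X fun x =>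
    δ ^ 2 * Ω.card ≤ 2 * ((P x ∩ P x₀).card : ℝ)] at h8
  set G := X.filter fun x => δ ^ 2 * Ω.card ≤ 2 * ((P x ∩ P x₀).card : ℝ)
  have h9 : ∑ x ∈ G, ((P x ∩ P x₀).card : ℝ) ≤ G.card * Ω.card := by
    rw [← nsmul_eq_mul]
    refine sum_le_card_nsmul _ _ _ fun x hx => ?_
    exact_mod_cast card_le_card (inter_subset_left.trans (hP x (mem_filter.1 hx).1))
  have h10 : ∑ x ∈ X.filter (fun x => ¬ δ ^ 2 * Ω.card ≤ 2 * ((P x ∩ P x₀).card : ℝ)),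
      2 * ((P x ∩ P x₀).card : ℝ) ≤ X.card * (δ ^ 2 * Ω.card) := by
    refine (sum_le_card_nsmul _ _ (δ ^ 2 * Ω.card) fun x hx => ?_).trans ?_
    · exact (not_le.1 (mem_filter.1 hx).2).le
    · rw [nsmul_eq_mul]
      gcongr
      exact filter_subset _ _
  rw [← mul_sum] at h10
  refine le_of_mul_le_mul_right (a := (Ω.card : ℝ)) ?_ hω
  linarith

end Paths

/-! ### Balog–Szemerédi–Gowers for dilates. -/

section BalogSzemerediGowers

open Finset
open scoped Pointwise

variable {𝔽 : Type*} [Field 𝔽] [DecidableEq 𝔽]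

/-- The Balog–Szemerédi–Gowers theorem for `A` and its dilate `ξ A`. -/
theorem exists_card_sub_smul_le_of_dilateEnergy {A : Finset 𝔽} {ξ : 𝔽} {K : ℝ}
    (hA : A.Nonempty) (hξ : ξ ≠ 0) (hK : 0 < K)
    (h : (A.card : ℝ) ^ 3 ≤ K * dilateEnergy A ξ) :
    ∃ A' ⊆ A, ∃ B' ⊆ A, (A.card : ℝ) ≤ 12 * K * A'.card ∧ (A.card : ℝ) ≤ 12 * K * B'.card ∧
      ((A' - ξ • B').card : ℝ) ≤ 10 ^ 5 * K ^ 5 * A.card := by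
  have hn : (0 : ℝ) < A.card := by exact_mod_cast hA.card_pos
  let f : 𝔽 × 𝔽 → 𝔽 := fun p => p.1 - ξ * p.2
  let ρ : 𝔽 → ℕ := fun d => ((A ×ˢ A).filter fun p => f p = d).card
  have hρ : ∀ d, ρ d ≤ A.card := fun d => by
    refine card_le_card_of_injOn Prod.snd ?_ ?_
    · intro p hp
      simp only [coe_filter, mem_product, Set.mem_ofPred_eq] at hp
      exact hp.1.2
    · rintro ⟨a, b⟩ hp ⟨a', b'⟩ hp' (rfl : b = b')
      simp only [coe_filter, mem_product, Set.mem_ofPred_eq, f] at hp hp'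
      have : a = a' := by linear_combination hp.2 - hp'.2
      rw [this]
  have hE : dilateEnergy A ξ = ∑ p ∈ A ×ˢ A, ρ (f p) := by
    have h1 : ∑ p ∈ A ×ˢ A, ρ (f p) =
        (((A ×ˢ A) ×ˢ (A ×ˢ A)).filter fun p => f p.2 = f p.1).card := by
      rw [card_filter, sum_product (A ×ˢ A) (A ×ˢ A)]
      exact sum_congr rfl fun v _ => card_filter (fun w => f w = f v) (A ×ˢ A)
    rw [h1, dilateEnergy]
    refine card_nbij' (fun t => ((t.1, t.2.2.1), (t.2.1, t.2.2.2)))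
      (fun t => (t.1.1, t.2.1, t.1.2, t.2.2)) ?_ ?_ (fun _ _ => rfl) fun _ _ => rfl
    · rintro ⟨a, b, c, d⟩ ht
      simp only [coe_filter, mem_product, Set.mem_ofPred_eq, f] at ht ⊢
      refine ⟨⟨⟨ht.1.1, ht.1.2.2.1⟩, ht.1.2.1, ht.1.2.2.2⟩, ?_⟩
      linear_combination -ht.2
    · rintro ⟨⟨a, b⟩, c, d⟩ ht
      simp only [coe_filter, mem_product, Set.mem_ofPred_eq, f] at ht ⊢
      refine ⟨⟨ht.1.1.1, ht.1.2.1, ht.1.1.2, ht.1.2.2⟩, ?_⟩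
      linear_combination -ht.2
  set G := (A ×ˢ A).filter fun p => (A.card : ℝ) ≤ 2 * K * ρ (f p) with hG
  have hGcard : (A.card : ℝ) ^ 2 ≤ 2 * K * G.card := by
    have h1 : (A.card : ℝ) ^ 3 ≤ K * ∑ p ∈ A ×ˢ A, (ρ (f p) : ℝ) := by
      rw [hE] at h
      exact_mod_cast h
    rw [← sum_filter_add_sum_filter_not (A ×ˢ A)
      fun p => (A.card : ℝ) ≤ 2 * K * ρ (f p)] at h1
    have h2 : ∑ p ∈ G, (ρ (f p) : ℝ) ≤ G.card * A.card := by
      rw [← nsmul_eq_mul]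
      exact sum_le_card_nsmul _ _ _ fun p _ => by exact_mod_cast hρ _
    have h3 : ∑ p ∈ (A ×ˢ A).filter (fun p => ¬ (A.card : ℝ) ≤ 2 * K * ρ (f p)),
        2 * K * (ρ (f p) : ℝ) ≤ (A ×ˢ A).card * A.card := by
      refine (sum_le_card_nsmul _ _ (A.card : ℝ) fun p hp => ?_).trans ?_
      · exact (not_le.1 (mem_filter.1 hp).2).le
      · rw [nsmul_eq_mul]
        gcongr
        exact filter_subset _ _
    rw [← mul_sum, card_product] at h3
    push_cast at h3
    have h4 : K * ∑ p ∈ G, (ρ (f p) : ℝ) ≤ K * (G.card * A.card) := by gcongr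
    refine le_of_mul_le_mul_right (a := (A.card : ℝ)) ?_ hn
    linarith
  set D := G.image f with hD
  have hDcard : (D.card : ℝ) * A.card ≤ 2 * K * G.card := by
    have h1 : (G.card : ℝ) = ∑ d ∈ D, ((G.filter fun p => f p = d).card : ℝ) := by
      exact_mod_cast card_eq_sum_card_image f G
    rw [h1, mul_sum, ← nsmul_eq_mul]
    refine card_nsmul_le_sum _ _ _ fun d hd => ?_
    obtain ⟨q, hq, rfl⟩ := mem_image.1 hd
    have h2 : (G.filter fun p => f p = f q) = (A ×ˢ A).filter fun p => f p = f q := by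
      ext p
      simp only [hG, mem_filter]
      refine ⟨fun h => ⟨h.1.1, h.2⟩, fun h => ⟨⟨h.1, ?_⟩, h.2⟩⟩
      rw [h.2]
      exact (mem_filter.1 hq).2
    rw [h2]
    exact (mem_filter.1 hq).2
  -- Keeping the true density `γ` instead of its lower bound `1 / (2K)` gives `|D| ≤ 2Kγ|A|`. Three
  -- factors `γ` then cancel against `γ⁵`, so the loss is `K⁵` rather than `K⁸`.
  obtain ⟨γ, hγ⟩ : ∃ γ : ℝ, γ = G.card / (A.card : ℝ) ^ 2 := ⟨_, rfl⟩
  have hγG : γ * (A.card : ℝ) ^ 2 = G.card := by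
    rw [hγ]
    field_simp
  have hγK : 1 ≤ 2 * K * γ := by
    refine le_of_mul_le_mul_right (a := (A.card : ℝ) ^ 2) ?_ (by positivity)
    rw [mul_assoc, hγG]
    linarith
  have hγ0 : 0 < γ := by
    by_contra! hle
    have : K * γ ≤ 0 := mul_nonpos_of_nonneg_of_nonpos hK.le hle
    linarith
  have hDγ : (D.card : ℝ) ≤ 2 * K * γ * A.card := by
    refine le_of_mul_le_mul_right (a := (A.card : ℝ)) ?_ hn
    refine hDcard.trans (le_of_eq ?_)
    rw [← hγG]
    ring
  obtain ⟨A', hA', B', hB', hA'c, hB'c, hpath⟩ := exists_many_paths_of_length_three A A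
    (fun a b => (A.card : ℝ) ≤ 2 * K * ρ (f (a, b))) hγ0 hA hA
    (by rw [← sq, hγG])
  refine ⟨A', hA', B', hB', ?_, ?_, ?_⟩
  · calc (A.card : ℝ) = 1 * A.card := (one_mul _).symm
      _ ≤ 2 * K * γ * A.card := by gcongr
      _ = 2 * K * (γ * A.card) := by ring
      _ ≤ 2 * K * (6 * A'.card) := by gcongr
      _ = _ := by ring
  · calc (A.card : ℝ) = 1 * A.card := (one_mul _).symm
      _ ≤ 2 * K * γ * A.card := by gcongr
      _ = 2 * K * (γ * A.card) := by ring
      _ ≤ 2 * K * (4 * B'.card) := by gcongr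
      _ = 8 * K * B'.card := by ring
      _ ≤ _ := by gcongr; norm_num
  · set U := A' - ξ • B' with hU
    -- A path gives `a - ξb = (a - ξb₁) - (a₁ - ξb₁) + (a₁ - ξb)` with all three terms in `D`, and
    -- the terms determine the path.
    have htriple : ∀ d ∈ U, γ ^ 5 * (A.card * A.card) ≤ 3072 *
        ((D ×ˢ D ×ˢ D).filter fun t => t.1 - t.2.1 + t.2.2 = d).card := by
      intro d hd
      obtain ⟨a, ha, w, hw, rfl⟩ := mem_sub.1 hd
      obtain ⟨b, hb, rfl⟩ := mem_smul_finset.1 hw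
      refine (hpath a ha b hb).trans ?_
      gcongr
      refine card_le_card_of_injOn
        (fun p => (f (a, p.2), f (p.1, p.2), f (p.1, b))) ?_ ?_
      · rintro ⟨a₁, b₁⟩ hp
        simp only [coe_filter, mem_product, Set.mem_ofPred_eq] at hp ⊢
        have hm : ∀ a ∈ A, ∀ b ∈ A, (A.card : ℝ) ≤ 2 * K * ρ (f (a, b)) → f (a, b) ∈ D :=
          fun a ha b hb h =>
            mem_image_of_mem f (mem_filter.2 ⟨mem_product.2 ⟨ha, hb⟩, h⟩)
        refine ⟨⟨hm _ (hA' ha) _ hp.1.2 hp.2.1, hm _ hp.1.1 _ hp.1.2 hp.2.2.1,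
          hm _ hp.1.1 _ (hB' hb) hp.2.2.2⟩, ?_⟩
        simp only [f, smul_eq_mul]
        ring
      · rintro ⟨a₁, b₁⟩ - ⟨a₂, b₂⟩ - heq
        simp only [Prod.mk.injEq, f] at heq
        have h1 : b₁ = b₂ := by
          refine mul_left_cancel₀ hξ ?_
          linear_combination -heq.1
        have h2 : a₁ = a₂ := by linear_combination heq.2.2
        rw [h1, h2]
    have h1 : (U.card : ℝ) * (γ ^ 5 * (A.card * A.card)) ≤ 3072 * (D.card : ℝ) ^ 3 := by
      rw [← nsmul_eq_mul]
      refine (card_nsmul_le_sum _ _ _ htriple).trans ?_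
      rw [← mul_sum]
      gcongr
      have h2 : ∑ d ∈ U, ((D ×ˢ D ×ˢ D).filter fun t => t.1 - t.2.1 + t.2.2 = d).card ≤
          (D ×ˢ D ×ˢ D).card := by
        rw [← card_biUnion]
        · exact card_le_card (biUnion_subset.2 fun d _ => filter_subset _ _)
        · intro d _ d' _ hne
          refine disjoint_filter.2 fun t _ h h' => hne (h.symm.trans h')
      rw [card_product, card_product] at h2
      have h3 : D.card * (D.card * D.card) = D.card ^ 3 := by ring
      rw [h3] at h2
      exact_mod_cast h2
    have h2 : (D.card : ℝ) ^ 3 ≤ (2 * K * γ * A.card) ^ 3 := by gcongr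
    have h3 : (U.card : ℝ) * γ ^ 2 ≤ 24576 * K ^ 3 * A.card := by
      refine le_of_mul_le_mul_right (a := γ ^ 3 * (A.card : ℝ) ^ 2) ?_ (by positivity)
      calc (U.card : ℝ) * γ ^ 2 * (γ ^ 3 * (A.card : ℝ) ^ 2)
          = U.card * (γ ^ 5 * (A.card * A.card)) := by ring
        _ ≤ 3072 * (2 * K * γ * A.card) ^ 3 := h1.trans (by gcongr)
        _ = _ := by ring
    calc (U.card : ℝ) = U.card * 1 ^ 2 := by ring
      _ ≤ U.card * (2 * K * γ) ^ 2 := by gcongr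
      _ = 4 * K ^ 2 * (U.card * γ ^ 2) := by ring
      _ ≤ 4 * K ^ 2 * (24576 * K ^ 3 * A.card) := by gcongr
      _ = 98304 * K ^ 5 * A.card := by ring
      _ ≤ _ := by gcongr; norm_num

end BalogSzemerediGowers

/-! ### From large energies to one set with many good dilates. -/

section LargeEnergy

open Finset
open scoped Pointwise

variable {𝔽 : Type*} [Field 𝔽] [DecidableEq 𝔽]

theorem Finset.card_sub_comm {G : Type*} [AddCommGroup G] [DecidableEq G] (A B : Finset G) :
    (A - B).card = (B - A).card := by
  rw [← card_neg, neg_sub]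

theorem Finset.smul_finset_sub_finset (x : 𝔽) (A B : Finset 𝔽) :
    x • (A - B) = x • A - x • B :=
  image_image₂_distrib (smul_sub x)

/-- Ruzsa's triangle inequality, combined along two pairs of sets whose first members and whose
second members meet. -/
theorem card_smul_finset_sub_finset_smul_mul_le {A₀ B₀ A B : Finset 𝔽} {x₀ x : 𝔽} (hx₀ : x₀ ≠ 0) (hx : x ≠ 0)
    {L : ℝ} (h₀ : ((A₀ - x₀ • B₀).card : ℝ) ≤ L) (h : ((A - x • B).card : ℝ) ≤ L) :
    ((x₀ • B₀ - x • B₀).card : ℝ) * (((A ∩ A₀).card * (B ∩ B₀).card) * A₀.card) ≤ L ^ 4 := by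
  set U := A ∩ A₀
  set W := B ∩ B₀
  have hL : 0 ≤ L := (Nat.cast_nonneg _).trans h
  -- The three bounds pass through `U`, then `x • W`, then `A₀`.
  have h1 : ((x₀ • B₀ - x • B₀).card : ℝ) * U.card ≤ L * (U - x • B₀).card := by
    have h2 := ruzsa_triangle_inequality_sub_sub_sub (x₀ • B₀) U (x • B₀)
    rw [card_sub_comm _ U, card_sub_comm _ U] at h2
    have h3 : ((U - x₀ • B₀).card : ℝ) ≤ L :=
      le_trans (by exact_mod_cast card_le_card (sub_subset_sub_right inter_subset_right)) h₀
    calc ((x₀ • B₀ - x • B₀).card : ℝ) * U.card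
        ≤ (U - x₀ • B₀).card * (U - x • B₀).card := by exact_mod_cast h2
      _ ≤ _ := by gcongr
  have h2 : ((U - x • B₀).card : ℝ) * W.card ≤ L * (B₀ - B₀).card := by
    have h2 := ruzsa_triangle_inequality_sub_sub_sub U (x • W) (x • B₀)
    rw [card_smul_finset₀ hx, ← smul_finset_sub_finset, card_smul_finset₀ hx] at h2
    have h3 : ((U - x • W).card : ℝ) ≤ L :=
      le_trans (Nat.cast_le.2 (card_le_card
        (sub_subset_sub inter_subset_left (smul_finset_subset_smul_finset inter_subset_left)))) h
    have h4 : (B₀ - W).card ≤ (B₀ - B₀).card :=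
      card_le_card (sub_subset_sub_left inter_subset_right)
    calc ((U - x • B₀).card : ℝ) * W.card
        ≤ (U - x • W).card * (B₀ - W).card := by exact_mod_cast h2
      _ ≤ _ := by gcongr
  have h3 : ((B₀ - B₀).card : ℝ) * A₀.card ≤ L * L := by
    have h2 := ruzsa_triangle_inequality_sub_sub_sub (x₀ • B₀) A₀ (x₀ • B₀)
    rw [← smul_finset_sub_finset, card_smul_finset₀ hx₀, card_sub_comm _ A₀] at h2
    calc ((B₀ - B₀).card : ℝ) * A₀.card
        ≤ (A₀ - x₀ • B₀).card * (A₀ - x₀ • B₀).card := by exact_mod_cast h2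
      _ ≤ _ := by gcongr
  calc ((x₀ • B₀ - x • B₀).card : ℝ) * ((U.card * W.card) * A₀.card)
      = ((x₀ • B₀ - x • B₀).card : ℝ) * U.card * (W.card * A₀.card) := by ring
    _ ≤ L * (U - x • B₀).card * (W.card * A₀.card) := by gcongr
    _ = L * A₀.card * ((U - x • B₀).card * W.card) := by ring
    _ ≤ L * A₀.card * (L * (B₀ - B₀).card) := by gcongr
    _ = L * L * ((B₀ - B₀).card * A₀.card) := by ring
    _ ≤ L * L * (L * L) := by gcongr
    _ = L ^ 4 := by ring

/-- If `E(A, ξA) ≥ |A|³ / K` for all `ξ ∈ X`, then there are a large subset `B` of `A` and a large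
subset `Y ∋ 1` of a dilate of `X` such that `|B - yB|` is small for all `y ∈ Y`. -/
theorem exists_card_sub_smul_le_of_forall_dilateEnergy {A X : Finset 𝔽} {K : ℝ}
    (hA : A.Nonempty) (hX : X.Nonempty) (hX0 : 0 ∉ X) (hK : 1 ≤ K)
    (h : ∀ ξ ∈ X, (A.card : ℝ) ^ 3 ≤ K * dilateEnergy A ξ) :
    ∃ B ⊆ A, ∃ x₀ ∈ X, ∃ Y ⊆ X.image fun x => x₀⁻¹ * x, 1 ∈ Y ∧ 0 ∉ Y ∧
      (A.card : ℝ) ≤ 12 * K * B.card ∧ (X.card : ℝ) ≤ 41472 * K ^ 4 * Y.card ∧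
      ∀ y ∈ Y, ((B - y • B).card : ℝ) ≤ 10 ^ 27 * K ^ 26 * B.card := by
  have hn : (0 : ℝ) < A.card := by exact_mod_cast hA.card_pos
  have hK0 : 0 < K := by linarith
  have hne : ∀ ξ ∈ X, ξ ≠ 0 := fun ξ hξ h => hX0 (h ▸ hξ)
  have hbsg : ∀ ξ : 𝔽, ∃ P : Finset 𝔽 × Finset 𝔽, ξ ∈ X → P.1 ⊆ A ∧ P.2 ⊆ A ∧
      (A.card : ℝ) ≤ 12 * K * P.1.card ∧ (A.card : ℝ) ≤ 12 * K * P.2.card ∧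
      ((P.1 - ξ • P.2).card : ℝ) ≤ 10 ^ 5 * K ^ 5 * A.card := fun ξ => by
    by_cases hξ : ξ ∈ X
    · obtain ⟨A', hA', B', hB', h1, h2, h3⟩ :=
        exists_card_sub_smul_le_of_dilateEnergy hA (hne ξ hξ) hK0 (h ξ hξ)
      exact ⟨(A', B'), fun _ => ⟨hA', hB', h1, h2, h3⟩⟩
    · exact ⟨(∅, ∅), fun h => absurd h hξ⟩
  choose P hP using hbsg
  obtain ⟨δ, hδ⟩ : ∃ δ : ℝ, δ = 1 / (144 * K ^ 2) := ⟨_, rfl⟩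
  have hδ0 : 0 < δ := by rw [hδ]; positivity
  have hδK : 144 * K ^ 2 * δ = 1 := by rw [hδ]; field_simp
  have hδ1 : δ ≤ 1 := by nlinarith
  have hdens : ∀ x ∈ X, δ * ((A ×ˢ A).card : ℝ) ≤ ((P x).1 ×ˢ (P x).2).card := by
    intro x hx
    obtain ⟨-, -, h1, h2, -⟩ := hP x hx
    rw [card_product, card_product]
    push_cast
    calc δ * ((A.card : ℝ) * A.card) ≤
          δ * ((12 * K * (P x).1.card) * (12 * K * (P x).2.card)) := by gcongr
      _ = (144 * K ^ 2 * δ) * ((P x).1.card * (P x).2.card) := by ring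
      _ = _ := by rw [hδK, one_mul]
  obtain ⟨x₀, hx₀, hx₀c⟩ := exists_many_large_inter X (A ×ˢ A)
    (fun x => (P x).1 ×ˢ (P x).2) hδ0 hX (hA.product hA)
    (fun x hx => product_subset_product (hP x hx).1 (hP x hx).2.1) hdens
  set X₁ := X.filter fun x => δ ^ 2 * ((A ×ˢ A).card : ℝ) ≤
    2 * ((((P x).1 ×ˢ (P x).2) ∩ ((P x₀).1 ×ˢ (P x₀).2)).card : ℝ) with hX₁
  -- This puts `1` in `Y`.
  have hx₀X₁ : x₀ ∈ X₁ := by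
    refine mem_filter.2 ⟨hx₀, ?_⟩
    rw [inter_self]
    have h1 := hdens x₀ hx₀
    have h2 : δ ^ 2 * ((A ×ˢ A).card : ℝ) ≤ δ * ((A ×ˢ A).card : ℝ) := by
      gcongr
      nlinarith
    have h3 : (0 : ℝ) ≤ ((P x₀).1 ×ˢ (P x₀).2).card := Nat.cast_nonneg _
    linarith
  have hx₀0 := hne x₀ hx₀
  obtain ⟨hA₀, hB₀, hA₀c, hB₀c, h₀⟩ := hP x₀ hx₀
  refine ⟨(P x₀).2, hB₀, x₀, hx₀, X₁.image fun x => x₀⁻¹ * x,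
    image_subset_image (filter_subset _ _), mem_image.2 ⟨x₀, hx₀X₁, inv_mul_cancel₀ hx₀0⟩,
    ?_, hB₀c, ?_, ?_⟩
  · rw [mem_image]
    rintro ⟨x, hx, hx'⟩
    exact mul_ne_zero (inv_ne_zero hx₀0) (hne x (mem_filter.1 hx).1) hx'
  · rw [card_image_of_injective _ (mul_right_injective₀ (inv_ne_zero hx₀0))]
    calc (X.card : ℝ) = (144 * K ^ 2 * δ) ^ 2 * X.card := by rw [hδK]; ring
      _ = 20736 * K ^ 4 * (δ ^ 2 * X.card) := by ring
      _ ≤ 20736 * K ^ 4 * (2 * X₁.card) := by gcongr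
      _ = _ := by ring
  · intro y hy
    obtain ⟨x, hx, rfl⟩ := mem_image.1 hy
    obtain ⟨hxX, hxc⟩ := mem_filter.1 hx
    have hx0 := hne x hxX
    have h1 := card_smul_finset_sub_finset_smul_mul_le hx₀0 hx0 h₀ (hP x hxX).2.2.2.2
    have h2 : ((P x₀).2 - (x₀⁻¹ * x) • (P x₀).2).card = (x₀ • (P x₀).2 - x • (P x₀).2).card := by
      rw [← card_smul_finset₀ hx₀0 ((P x₀).2 - _), smul_finset_sub_finset, smul_smul,
        mul_inv_cancel_left₀ hx₀0]
    rw [h2]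
    rw [product_inter_product, card_product, card_product] at hxc
    push_cast at hxc
    set u : ℝ := (((P x).1 ∩ (P x₀).1).card : ℝ)
    set w : ℝ := (((P x).2 ∩ (P x₀).2).card : ℝ)
    set ρ : ℝ := ((x₀ • (P x₀).2 - x • (P x₀).2).card : ℝ)
    have hρ : 0 ≤ ρ := Nat.cast_nonneg _
    have hu : 0 ≤ u := Nat.cast_nonneg _
    have hw : 0 ≤ w := Nat.cast_nonneg _
    have h3 : (A.card : ℝ) ^ 2 ≤ 41472 * K ^ 4 * (u * w) := by
      calc (A.card : ℝ) ^ 2 = (144 * K ^ 2 * δ) ^ 2 * A.card ^ 2 := by rw [hδK]; ring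
        _ = 20736 * K ^ 4 * (δ ^ 2 * (A.card * A.card)) := by ring
        _ ≤ 20736 * K ^ 4 * (2 * (u * w)) := by gcongr
        _ = _ := by ring
    have h4 : ρ * (A.card : ℝ) ^ 3 ≤ 497664 * 10 ^ 20 * K ^ 25 * A.card * (A.card : ℝ) ^ 3 := by
      calc ρ * (A.card : ℝ) ^ 3 = ρ * (A.card ^ 2 * A.card) := by ring
        _ ≤ ρ * ((41472 * K ^ 4 * (u * w)) * (12 * K * (P x₀).1.card)) := by gcongr
        _ = 497664 * K ^ 5 * (ρ * ((u * w) * (P x₀).1.card)) := by ring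
        _ ≤ 497664 * K ^ 5 * (10 ^ 5 * K ^ 5 * A.card) ^ 4 := by gcongr
        _ = _ := by ring
    have h5 := le_of_mul_le_mul_right h4 (by positivity)
    calc ρ ≤ 497664 * 10 ^ 20 * K ^ 25 * A.card := h5
      _ ≤ 497664 * 10 ^ 20 * K ^ 25 * (12 * K * (P x₀).2.card) := by gcongr
      _ = 5971968 * 10 ^ 20 * K ^ 26 * (P x₀).2.card := by ring
      _ ≤ _ := by gcongr; norm_num

/-- The structure theorem when every dilate has large energy, with explicit constants. -/
theorem exists_span_of_forall_dilateEnergy [Finite 𝔽] {A X : Finset 𝔽} {K c : ℝ}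
    (hA : A.Nonempty) (hX0 : 0 ∉ X) (hK : 1 ≤ K) (hc : c = 16 * 4 ^ 24 * (10 ^ 27) ^ 27)
    (hX : c * K ^ 1504 ≤ X.card)
    (h : ∀ ξ ∈ X, (A.card : ℝ) ^ 3 ≤ K * dilateEnergy A ξ) :
    ∃ a ∈ A, ∃ x₀ ∈ X, ∃ A₁ ⊆ A.image fun x => x - a, ∃ Y ⊆ X.image fun x => x₀⁻¹ * x,
      (Nat.card (Submodule.span (Subfield.closure (Y : Set 𝔽)) (A₁ : Set 𝔽)) : ℝ) ≤
        c * K ^ 704 * A₁.card ∧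
      (A.card : ℝ) ≤ c * K ^ 85 * A₁.card ∧ (X.card : ℝ) ≤ c * K ^ 4 * Y.card := by
  have hK0 : 0 < K := by linarith
  have hc0 : 0 < c := by rw [hc]; positivity
  have hXne : X.Nonempty := by
    have : (0 : ℝ) < X.card := lt_of_lt_of_le (by positivity) hX
    exact card_pos.1 (by exact_mod_cast this)
  obtain ⟨B, hBA, x₀, hx₀, Y, hYX, hY1, hY0, hAB, hXY, hY⟩ :=
    exists_card_sub_smul_le_of_forall_dilateEnergy hA hXne hX0 hK h
  have hn : (0 : ℝ) < A.card := by exact_mod_cast hA.card_pos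
  have hBne : B.Nonempty := by
    rw [nonempty_iff_ne_empty]
    rintro rfl
    rw [card_empty, Nat.cast_zero, mul_zero] at hAB
    linarith
  obtain ⟨T, hT⟩ : ∃ T : ℝ, T = 10 ^ 27 * K ^ 26 := ⟨_, rfl⟩
  rw [← hT] at hY
  have hT1 : 1 ≤ T := by
    rw [hT]
    exact one_le_mul_of_one_le_of_one_le (by norm_num) (one_le_pow₀ hK)
  obtain ⟨b₀, hb₀, hb₀c⟩ := exists_many_mul_mem_sub hBne hT1 hY ⟨1, hY1⟩
  set G := B.filter fun b => (Y.card : ℝ) ≤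
      2 * T * (Y.filter fun x => x * (b - b₀) ∈ B - B).card with hG
  have hcardG : (G.image fun x => x - b₀).card = G.card :=
    card_image_of_injective _ (sub_left_injective)
  have hpow : ∀ m n : ℕ, m ≤ n → K ^ m ≤ K ^ n := fun m n hmn => pow_le_pow_right₀ hK hmn
  refine ⟨b₀, hBA hb₀, x₀, hx₀, G.image fun x => x - b₀,
    image_subset_image ((filter_subset _ _).trans hBA), Y, hYX, ?_, ?_, ?_⟩
  · have hspan := card_span_le (A := G.image fun x => x - b₀) hBne hT1 hY0 hY1 hY ?_ ?_
    · rw [hcardG]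
      refine hspan.trans ?_
      -- In total `T²⁷`, hence `K⁷⁰²`; the value of `c` is exactly the constant arising here.
      calc 8 * T ^ 2 * ((4 * T) ^ 8) ^ 3 * B.card
          ≤ 8 * T ^ 2 * ((4 * T) ^ 8) ^ 3 * (2 * T * G.card) := by gcongr
        _ = c * K ^ 702 * G.card := by rw [hc, hT]; ring
        _ ≤ c * K ^ 704 * G.card := by
          gcongr
          norm_num
    · intro a ha
      obtain ⟨b, hb, rfl⟩ := mem_image.1 ha
      exact (mem_filter.1 hb).2
    -- Only `T²⁶ · K⁴`, that is `K⁶⁸⁰`, is needed, well within the assumed `K¹⁵⁰⁴`.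
    · refine le_of_mul_le_mul_left (a := 41472 * K ^ 4) ?_ (by positivity)
      refine le_trans ?_ (hX.trans hXY)
      calc 41472 * K ^ 4 * (8 * T ^ 2 * ((4 * T) ^ 8) ^ 3)
          = 41472 * 8 * 4 ^ 24 * (10 ^ 27) ^ 26 * K ^ 680 := by rw [hT]; ring
        _ ≤ c * K ^ 680 := by
          gcongr
          rw [hc]
          norm_num
        _ ≤ c * K ^ 1504 := by
          gcongr
          norm_num
  · rw [hcardG]
    calc (A.card : ℝ) ≤ 12 * K * B.card := hAB
      _ ≤ 12 * K * (2 * T * G.card) := by gcongr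
      _ = 24 * 10 ^ 27 * K ^ 27 * G.card := by rw [hT]; ring
      _ ≤ c * K ^ 85 * G.card := by
        gcongr
        · rw [hc]
          norm_num
        · norm_num
  · refine hXY.trans ?_
    gcongr
    rw [hc]
    norm_num

theorem dilateEnergy_le (A : Finset 𝔽) (ξ : 𝔽) : dilateEnergy A ξ ≤ A.card ^ 3 := by
  have h : A.card ^ 3 = (A ×ˢ A ×ˢ A).card := by
    rw [card_product, card_product]
    ring
  rw [h]
  refine card_le_card_of_injOn (fun t => t.2) ?_ ?_
  · intro t ht
    simp only [coe_filter, mem_product, Set.mem_ofPred_eq] at ht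
    simp [ht.1.2]
  · rintro ⟨a, b⟩ ht ⟨a', b'⟩ ht' (rfl : b = b')
    simp only [coe_filter, mem_product, Set.mem_ofPred_eq] at ht ht'
    have : a = a' := by linear_combination ht.2 - ht'.2
    rw [this]

/-- Large energy on average gives large energy for many dilates. -/
theorem card_le_card_filter_dilateEnergy {A X : Finset 𝔽} {K : ℝ} (hA : A.Nonempty) (hK : 0 < K)
    (h : (A.card : ℝ) ^ 3 * X.card / K ≤ ∑ ξ ∈ X, (dilateEnergy A ξ : ℝ)) :
    (X.card : ℝ) ≤ 2 * K *
      (X.filter fun ξ => (A.card : ℝ) ^ 3 ≤ 2 * K * dilateEnergy A ξ).card := by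
  have hn : (0 : ℝ) < A.card := by exact_mod_cast hA.card_pos
  rw [div_le_iff₀ hK, ← sum_filter_add_sum_filter_not X
    fun ξ => (A.card : ℝ) ^ 3 ≤ 2 * K * dilateEnergy A ξ] at h
  set G := X.filter fun ξ => (A.card : ℝ) ^ 3 ≤ 2 * K * dilateEnergy A ξ
  have h1 : ∑ ξ ∈ G, (dilateEnergy A ξ : ℝ) ≤ G.card * (A.card : ℝ) ^ 3 := by
    rw [← nsmul_eq_mul]
    exact sum_le_card_nsmul _ _ _ fun ξ _ => by exact_mod_cast dilateEnergy_le A ξ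
  have h2 : ∑ ξ ∈ X.filter (fun ξ => ¬ (A.card : ℝ) ^ 3 ≤ 2 * K * dilateEnergy A ξ),
      2 * K * (dilateEnergy A ξ : ℝ) ≤ X.card * (A.card : ℝ) ^ 3 := by
    refine (sum_le_card_nsmul _ _ ((A.card : ℝ) ^ 3) fun ξ hξ => ?_).trans ?_
    · exact (not_le.1 (mem_filter.1 hξ).2).le
    · rw [nsmul_eq_mul]
      gcongr
      exact filter_subset _ _
  rw [← mul_sum] at h2
  have h3 : K * ∑ ξ ∈ G, (dilateEnergy A ξ : ℝ) ≤ K * (G.card * (A.card : ℝ) ^ 3) := by gcongr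
  refine le_of_mul_le_mul_right (a := (A.card : ℝ) ^ 3) ?_ (by positivity)
  linarith

end LargeEnergy

/-! ### Assembly of the theorem. -/

/-- Moving a power of `K` to the other side of an inequality. -/
theorem zpow_neg_mul_le_of_le_mul_pow {K C s t : ℝ} {n : ℕ} (hK : 0 < K)
    (h : s ≤ C * K ^ n * t) : K ^ (-(n : ℤ)) * s ≤ C * t := by
  rw [zpow_neg, zpow_natCast, inv_mul_le_iff₀ (by positivity)]
  linarith

/-- The span of `A₁` meets any set containing `A₁` in at least `|A₁|` elements. -/
theorem card_le_ncard_span_inter {𝔽 : Type*} [Field 𝔽] {F : Subfield 𝔽} {A₁ A₂ : Finset 𝔽}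
    (h : A₁ ⊆ A₂) :
    (A₁.card : ℝ) ≤ (((Submodule.span F (A₁ : Set 𝔽) : Set 𝔽) ∩ (A₂ : Set 𝔽)).ncard : ℝ) := by
  rw [← Set.ncard_coe_finset A₁]
  exact_mod_cast Set.ncard_le_ncard
    (Set.subset_inter Submodule.subset_span (Finset.coe_subset.2 h))
    (A₂.finite_toSet.subset Set.inter_subset_right)

theorem theoremC :
    ∃ (C₀ C : ℝ) (k₀ k : ℕ), 0 < C₀ ∧ 0 < C ∧
      ∀ (𝔽 : Type*) [Field 𝔽] [Fintype 𝔽] [DecidableEq 𝔽] (A X : Finset 𝔽) (K : ℝ),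
        A.Nonempty → (0 : 𝔽) ∉ A → (0 : 𝔽) ∉ X → 1 ≤ K →
        -- the general case
        (logLoss 𝔽 C₀ k₀ * K ^ 1505 ≤ (X.card : ℝ) →
          (∑ ξ ∈ X, (dilateEnergy A ξ : ℝ)) ≥ (A.card : ℝ) ^ 3 * (X.card : ℝ) / K →
          ∃ a ∈ A, ∃ (F : Subfield 𝔽) (V : Submodule F 𝔽),
            max (K ^ (-704 : ℤ) * (Nat.card V : ℝ)) (K ^ (-85 : ℤ) * (A.card : ℝ)) ≤
              logLoss 𝔽 C k *
                (((V : Set 𝔽) ∩ (A.image fun x => x - a : Finset 𝔽)).ncard : ℝ) ∧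
            ∃ x₀ ∈ X, ∃ A₁ X' : Finset 𝔽,
              A₁ ⊆ (A.image fun x => x - a) ∧ X' ⊆ (X.image fun x => x₀⁻¹ * x) ∧
              F = Subfield.closure (X' : Set 𝔽) ∧
              V = Submodule.span F (A₁ : Set 𝔽) ∧
              K ^ (-85 : ℤ) * (A.card : ℝ) ≤ logLoss 𝔽 C k * (A₁.card : ℝ) ∧
              K ^ (-5 : ℤ) * (X.card : ℝ) ≤ logLoss 𝔽 C k * (X'.card : ℝ)) ∧
        -- the case in which every dilate has large energy
        (logLoss 𝔽 C₀ k₀ * K ^ 1504 ≤ (X.card : ℝ) →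
          (∀ ξ ∈ X, (dilateEnergy A ξ : ℝ) ≥ (A.card : ℝ) ^ 3 / K) →
          ∃ a ∈ A, ∃ (F : Subfield 𝔽) (V : Submodule F 𝔽),
            max (K ^ (-704 : ℤ) * (Nat.card V : ℝ)) (K ^ (-85 : ℤ) * (A.card : ℝ)) ≤
              logLoss 𝔽 C k *
                (((V : Set 𝔽) ∩ (A.image fun x => x - a : Finset 𝔽)).ncard : ℝ) ∧
            ∃ x₀ ∈ X, ∃ A₁ X' : Finset 𝔽,
              A₁ ⊆ (A.image fun x => x - a) ∧ X' ⊆ (X.image fun x => x₀⁻¹ * x) ∧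
              F = Subfield.closure (X' : Set 𝔽) ∧
              V = Submodule.span F (A₁ : Set 𝔽) ∧
              K ^ (-85 : ℤ) * (A.card : ℝ) ≤ logLoss 𝔽 C k * (A₁.card : ℝ) ∧
              K ^ (-4 : ℤ) * (X.card : ℝ) ≤ logLoss 𝔽 C k * (X'.card : ℝ)) := by
  obtain ⟨c, hc⟩ : ∃ c : ℝ, c = 16 * 4 ^ 24 * (10 ^ 27) ^ 27 := ⟨_, rfl⟩
  have hc0 : 0 < c := by rw [hc]; positivity
  -- No logarithms are lost, so both exponents are `0`. The powers of `2` come from replacing `K` by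
  -- `2K` in the averaged case.
  refine ⟨c * 2 ^ 1505, c * 2 ^ 704, 0, 0, by positivity, by positivity, ?_⟩
  intro 𝔽 _ _ _ A X K hA _ hX0 hK
  have hK0 : 0 < K := by linarith
  simp only [logLoss, pow_zero, mul_one]
  have hpow : ∀ m : ℕ, m ≤ 704 → c * 2 ^ m ≤ c * 2 ^ 704 := fun m hm => by
    gcongr
    exact one_le_two
  have hc_le : c ≤ c * 2 ^ 704 := by simpa using hpow 0 (by norm_num)
  constructor
  · intro hX hE
    -- Passing to the popular dilates shrinks `X` by a factor `2K` at most, the source of the extra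
    -- `K` in `K ^ 1505` and in the bound for `X'`.
    have hX₁ := card_le_card_filter_dilateEnergy hA hK0 hE
    set X₁ := X.filter fun ξ => (A.card : ℝ) ^ 3 ≤ 2 * K * dilateEnergy A ξ
    have hX₁X : X₁ ⊆ X := Finset.filter_subset _ _
    have hX₁card : c * (2 * K) ^ 1504 ≤ X₁.card := by
      refine le_of_mul_le_mul_left (a := 2 * K) ?_ (by positivity)
      calc 2 * K * (c * (2 * K) ^ 1504) = c * (2 ^ 1504 * 2) * (K ^ 1504 * K) := by
            rw [mul_pow]; ring
        _ = c * 2 ^ 1505 * K ^ 1505 := by rw [← pow_succ, ← pow_succ]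
        _ ≤ X.card := hX
        _ ≤ _ := hX₁
    obtain ⟨a, ha, x₀, hx₀, A₁, hA₁, Y, hY, hV, hAA₁, hXY⟩ :=
      exists_span_of_forall_dilateEnergy (A := A) (X := X₁) (K := 2 * K) hA
        (fun h => hX0 (hX₁X h)) (by linarith) hc hX₁card fun ξ hξ => (Finset.mem_filter.1 hξ).2
    have hN := card_le_ncard_span_inter (F := Subfield.closure (Y : Set 𝔽)) hA₁
    have hA85 : (A.card : ℝ) ≤ c * 2 ^ 704 * K ^ 85 * A₁.card := by
      refine hAA₁.trans ?_
      rw [mul_pow, ← mul_assoc]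
      gcongr ?_ * _ * _
      exact hpow 85 (by norm_num)
    have hV704 := hV
    rw [mul_pow, ← mul_assoc] at hV704
    refine ⟨a, ha, Subfield.closure (Y : Set 𝔽), Submodule.span _ (A₁ : Set 𝔽), ?_, x₀,
      hX₁X hx₀, A₁, Y, hA₁, hY.trans (Finset.image_subset_image hX₁X), rfl, rfl, ?_, ?_⟩
    · refine max_le ?_ ?_
      · exact zpow_neg_mul_le_of_le_mul_pow hK0 (n := 704) (hV704.trans (by gcongr))
      · exact zpow_neg_mul_le_of_le_mul_pow hK0 (n := 85) (hA85.trans (by gcongr))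
    · exact zpow_neg_mul_le_of_le_mul_pow hK0 (n := 85) hA85
    · refine zpow_neg_mul_le_of_le_mul_pow hK0 (n := 5) ?_
      calc (X.card : ℝ) ≤ 2 * K * X₁.card := hX₁
        _ ≤ 2 * K * (c * (2 * K) ^ 4 * Y.card) := by gcongr
        _ = c * 2 ^ 5 * K ^ 5 * Y.card := by ring
        _ ≤ c * 2 ^ 704 * K ^ 5 * Y.card := by
          gcongr ?_ * _ * _
          exact hpow 5 (by norm_num)
  · intro hX hE
    have hXcard : c * K ^ 1504 ≤ X.card := by
      refine le_trans ?_ hX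
      gcongr
      exact le_mul_of_one_le_right hc0.le (one_le_pow₀ one_le_two)
    obtain ⟨a, ha, x₀, hx₀, A₁, hA₁, Y, hY, hV, hAA₁, hXY⟩ :=
      exists_span_of_forall_dilateEnergy (A := A) (X := X) (K := K) hA hX0 hK hc hXcard
        fun ξ hξ => by
          have := hE ξ hξ
          rw [ge_iff_le, div_le_iff₀ hK0] at this
          linarith
    have hN := card_le_ncard_span_inter (F := Subfield.closure (Y : Set 𝔽)) hA₁
    have hA85 : (A.card : ℝ) ≤ c * 2 ^ 704 * K ^ 85 * A₁.card := hAA₁.trans (by gcongr)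
    refine ⟨a, ha, Subfield.closure (Y : Set 𝔽), Submodule.span _ (A₁ : Set 𝔽), ?_, x₀,
      hx₀, A₁, Y, hA₁, hY, rfl, rfl, ?_, ?_⟩
    · refine max_le ?_ ?_
      · exact zpow_neg_mul_le_of_le_mul_pow hK0 (n := 704) (hV.trans (by gcongr))
      · exact zpow_neg_mul_le_of_le_mul_pow hK0 (n := 85) (hA85.trans (by gcongr))
    · exact zpow_neg_mul_le_of_le_mul_pow hK0 (n := 85) hA85
    · exact zpow_neg_mul_le_of_le_mul_pow hK0 (n := 4) (hXY.trans (by gcongr))
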